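/- **Model.** Let $T_s>0$, let $s_1,s_2\in L^2(\mathbb R)$ be real waveforms vanishing outside $[0,2T_s]$ with $\int_0^{2T_s}|s_j(t)|^2\,dt=1$, let the delays satisfy $0<\tau_2-\tau_1<T_s$, let $\alpha_1,\alpha_2\in\mathbb C$ be (fixed) channel gains from the two relays to the destination, and let $\hat P_s,\mathcal N_0>0$, $\mathrm{SNR}=\hat P_s/\mathcal N_0$, $m=3$ (the number of potential transmitting nodes: the source and two relays). Put $$a_1=\int_0^{T_s}s_1(t)s_1(t+T_s)\,dt,\quad d_1=\int_0^{T_s}s_2(t)s_2(t+T_s)\,dt,\quad c_0=\int_0^{2T_s}s_1(t)s_2(t-\tau_2+\tau_1)\,dt,$$ $$c_1=\int_0^{2T_s}s_1(t)s_2(t+T_s+\tau_1-\tau_2)\,dt,\quad f_1=\int_0^{T_s}s_2(t)s_1(t+T_s+\tau_2-\tau_1)\,dt,\quad c_2=\int_0^{T_s}s_1(t)s_2(t+2T_s-\tau_2+\tau_1)\,dt .$$ Let $$H_E(0)=\begin{pmatrix}|\alpha_1|^2&c_0\alpha_1^*\alpha_2\\ c_0\alpha_2^*\alpha_1&|\alpha_2|^2\end{pmatrix},\quad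 H_E(1)=H_E(-1)^\dagger=\begin{pmatrix}a_1|\alpha_1|^2&c_1\alpha_1^*\alpha_2\\ f_1\alpha_2^*\alpha_1&d_1|\alpha_2|^2\end{pmatrix},\quad H_E(2)=H_E(-2)^\dagger=\begin{pmatrix}0&c_2\alpha_1^*\alpha_2\\0&0\end{pmatrix},$$ $H_E(i)=0$ for $|i|>2$, and let $\mathcal H_E^{(n)}=(H_E(k-l))_{k,l=1}^n$. The asynchronous $2\times2$ vector-ISI channel with block length $n$ is $y^n=\mathcal H_E^{(n)}b^n+z^n$, where $b^n$ and $z^n$ are independent zero-mean proper complex Gaussian vectors in $\mathbb C^{2n}$ with covariance matrices $\frac2m\hat P_s I_{2n}$ and $\mathcal N_0\mathcal H_E^{(n)}$. Its normalized mutual information is $I^{(n)}=\frac1n I(y^n;b^n)$ ($\log$ is natural; another base rescales everything). Let $T^n(1,1),T^n(2,2),T^n(1,2)$ be the $n\times n$ Toeplitz matrices with $(k,l)$ entry $t_{k-l}$ for the sequences $t(1,1)$: $t_0=1,\ t_{\pm1}=a_1$; $t(2,2)$: $t_0=1,\ t_{\pm1}=d_1$; $t(1,2)$: $t_{-1}=f_1,\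 t_0=c_0,\ t_1=c_1,\ t_2=c_2$ (all other terms zero); let $T^n(2,1)=T^n(1,2)^\dagger$, and $$\mathcal T^{(2n)}=\begin{pmatrix}|\alpha_1|^2T^n(1,1)&\alpha_1\alpha_2^*T^n(1,2)\\ \alpha_1^*\alpha_2T^n(2,1)&|\alpha_2|^2T^n(2,2)\end{pmatrix}.$$ **Theorem 6.** For every $n$, $I(y^n;b^n)$ is finite and $I(y^n;b^n)=\log\det\bigl(I_{2n}+\tfrac2m\mathrm{SNR}\,\mathcal T^{(2n)}\bigr)$. As $n\to\infty$, $$\lim_{n\to\infty}I^{(n)}=\lim_{n\to\infty}\frac1n\log\det\Bigl(I_{2n}+\frac2m\mathrm{SNR}\,\mathcal T^{(2n)}\Bigr)=\frac1{2\pi}\int_{-\pi}^{\pi}\sum_{j=1}^2\log\Bigl[1+\frac2m\mathrm{SNR}\cdot\nu_j(T_E(\omega))\Bigr]d\omega,$$ the integrand being integrable, where $\nu_j(T_E(\omega))$ is the $j$th largest eigenvalue of the Hermitian matrix $$T_E(\omega)=\begin{pmatrix}|\alpha_1|^2t^{(1,1)}(\omega)&\alpha_1\alpha_2^*t^{(1,2)}(\omega)\\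 \alpha_1^*\alpha_2t^{(2,1)}(\omega)&|\alpha_2|^2t^{(2,2)}(\omega)\end{pmatrix}$$ and $t^{(j,l)}(\omega)=\sum_k t_k(j,l)e^{-ik\omega}$ is the discrete-time Fourier transform of the sequence generating $T^n(j,l)$; explicitly $$t^{(1,1)}(\omega)=1+a_1e^{-i\omega}+a_1e^{i\omega},\qquad t^{(2,2)}(\omega)=1+d_1e^{-i\omega}+d_1e^{i\omega},$$ $$t^{(1,2)}(\omega)=c_1e^{-i\omega}+c_2e^{-2i\omega}+c_0+f_1e^{i\omega}=\bigl(t^{(2,1)}(\omega)\bigr)^*.$$ -/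

import Mathlib

open MeasureTheory ProbabilityTheory

/-- The mutual information `I(X; Y)` (in nats) of two random variables: the Kullback-Leibler
divergence of their joint law from the product of their laws. -/
noncomputable def mutualInfo {Ω E F : Type*} [MeasurableSpace Ω] [MeasurableSpace E]
    [MeasurableSpace F] (P : Measure Ω) (X : Ω → E) (Y : Ω → F) : ENNReal :=
  InformationTheory.klDiv (P.map fun w => (X w, Y w)) ((P.map X).prod (P.map Y))

/-- `X` is a zero-mean proper (circularly symmetric) complex Gaussian random vector with
covariance matrix `E[X X†] = S`. -/
structure IsProperComplexGaussian {Ω ι : Type*} [MeasurableSpace Ω] [Fintype ι]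
    (P : Measure Ω) (X : Ω → ι → ℂ) (S : Matrix ι ι ℂ) : Prop where
  gaussian : HasGaussianLaw X P
  mean : ∀ i, ∫ w, X w i ∂P = 0
  covariance : ∀ i j, ∫ w, X w i * starRingEnd ℂ (X w j) ∂P = S i j
  pseudoCovariance : ∀ i j, ∫ w, X w i * X w j ∂P = 0

/-- The second hop of the relay network: two relays (indices `0`, `1`) send linearly modulated
signals with waveforms `s 0`, `s 1` over flat channels with gains `α 0`, `α 1` and delays
`τ 0`, `τ 1`. -/
structure RelayLink where
  /-- symbol period -/
  Ts : ℝ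
  /-- baseband waveforms -/
  s : Fin 2 → ℝ → ℝ
  /-- delays -/
  τ : Fin 2 → ℝ
  /-- channel gains -/
  α : Fin 2 → ℂ
  /-- discrete-time transmission power of a node -/
  Ps : ℝ
  /-- noise power spectral density -/
  N0 : ℝ
  Ts_pos : 0 < Ts
  s_support : ∀ j, ∀ t, t ∉ Set.Icc 0 (2 * Ts) → s j t = 0
  s_memLp : ∀ j, MemLp (s j) 2 volume
  s_energy : ∀ j, ∫ t in (0 : ℝ)..(2 * Ts), |s j t| ^ 2 = 1
  delay_pos : 0 < τ 1 - τ 0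
  delay_lt : τ 1 - τ 0 < Ts
  Ps_pos : 0 < Ps
  N0_pos : 0 < N0

/-- The number of potential transmitting nodes (the source and `2` relays). -/
def numTransmitters : ℕ := 3

namespace RelayLink

variable (L : RelayLink)

noncomputable section

/-- `SNR = P̂ₛ / N₀`. -/
def snr : ℝ := L.Ps / L.N0

/-- Power `(2 / m) P̂ₛ` of each symbol sent by a relay. -/
def symbolPower : ℝ := 2 / (numTransmitters : ℝ) * L.Ps

/-! Waveform correlation coefficients. -/

def a₁ : ℝ := ∫ t in (0 : ℝ)..L.Ts, L.s 0 t * L.s 0 (t + L.Ts)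

def d₁ : ℝ := ∫ t in (0 : ℝ)..L.Ts, L.s 1 t * L.s 1 (t + L.Ts)

def c₀ : ℝ := ∫ t in (0 : ℝ)..(2 * L.Ts), L.s 0 t * L.s 1 (t - L.τ 1 + L.τ 0)

def c₁ : ℝ := ∫ t in (0 : ℝ)..(2 * L.Ts), L.s 0 t * L.s 1 (t + L.Ts + L.τ 0 - L.τ 1)

def f₁ : ℝ := ∫ t in (0 : ℝ)..L.Ts, L.s 1 t * L.s 0 (t + L.Ts + L.τ 1 - L.τ 0)

def c₂ : ℝ := ∫ t in (0 : ℝ)..L.Ts, L.s 0 t * L.s 1 (t + 2 * L.Ts - L.τ 1 + L.τ 0)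

/-! The vector inter-symbol-interference channel. -/

/-- `H_E(0)`. -/
def HE0 : Matrix (Fin 2) (Fin 2) ℂ :=
  !![((‖L.α 0‖ ^ 2 : ℝ) : ℂ), L.c₀ * (starRingEnd ℂ (L.α 0) * L.α 1);
     L.c₀ * (starRingEnd ℂ (L.α 1) * L.α 0), ((‖L.α 1‖ ^ 2 : ℝ) : ℂ)]

/-- `H_E(1)`. -/
def HE1 : Matrix (Fin 2) (Fin 2) ℂ :=
  !![L.a₁ * ((‖L.α 0‖ ^ 2 : ℝ) : ℂ), L.c₁ * (starRingEnd ℂ (L.α 0) * L.α 1);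
     L.f₁ * (starRingEnd ℂ (L.α 1) * L.α 0), L.d₁ * ((‖L.α 1‖ ^ 2 : ℝ) : ℂ)]

/-- `H_E(2)`. -/
def HE2 : Matrix (Fin 2) (Fin 2) ℂ :=
  !![0, L.c₂ * (starRingEnd ℂ (L.α 0) * L.α 1); 0, 0]

/-- The matrix taps `H_E(i)`, with `H_E(-i) = H_E(i)†` and `H_E(i) = 0` for `|i| > 2`. -/
def HE (i : ℤ) : Matrix (Fin 2) (Fin 2) ℂ :=
  if i = 0 then L.HE0
  else if i = 1 then L.HE1
  else if i = -1 then L.HE1.conjTranspose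
  else if i = 2 then L.HE2
  else if i = -2 then L.HE2.conjTranspose
  else 0

/-- The block Toeplitz matrix of the channel over `n` symbol periods; the `(k, l)` block is
`H_E(k - l)`. -/
def channelMatrix (n : ℕ) : Matrix (Fin n × Fin 2) (Fin n × Fin 2) ℂ :=
  Matrix.of fun x y => L.HE ((x.1 : ℤ) - (y.1 : ℤ)) x.2 y.2

/-- The channel output `y = H_E b + z` over `n` symbol periods. -/
def output {Ω : Type*} (n : ℕ) (b z : Ω → Fin n × Fin 2 → ℂ) (w : Ω) : Fin n × Fin 2 → ℂ :=
  (L.channelMatrix n).mulVec (b w) + z w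

/-! The Toeplitz blocks and their symbol. -/

/-- Generating sequence of the `(1,1)` block. -/
def t₁₁ (k : ℤ) : ℂ := if k = 0 then 1 else if k = 1 ∨ k = -1 then L.a₁ else 0

/-- Generating sequence of the `(2,2)` block. -/
def t₂₂ (k : ℤ) : ℂ := if k = 0 then 1 else if k = 1 ∨ k = -1 then L.d₁ else 0

/-- Generating sequence of the `(1,2)` block. -/
def t₁₂ (k : ℤ) : ℂ :=
  if k = 0 then L.c₀ else if k = 1 then L.c₁ else if k = 2 then L.c₂
  else if k = -1 then L.f₁ else 0

/-- Generating sequence of the `(2,1)` block, the conjugate transpose of the `(1,2)` block. -/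
def t₂₁ (k : ℤ) : ℂ := starRingEnd ℂ (L.t₁₂ (-k))

/-- The `n × n` Toeplitz matrix with entries `t (k - l)`. -/
def toeplitz (t : ℤ → ℂ) (n : ℕ) : Matrix (Fin n) (Fin n) ℂ :=
  Matrix.of fun k l => t ((k : ℤ) - (l : ℤ))

/-- The `2n × 2n` Hermitian matrix `T^(2n)` made of four `n × n` Toeplitz blocks. -/
def blockMatrix (n : ℕ) : Matrix (Fin n ⊕ Fin n) (Fin n ⊕ Fin n) ℂ :=
  Matrix.fromBlocks
    (((‖L.α 0‖ ^ 2 : ℝ) : ℂ) • toeplitz L.t₁₁ n)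
    ((L.α 0 * starRingEnd ℂ (L.α 1)) • toeplitz L.t₁₂ n)
    ((starRingEnd ℂ (L.α 0) * L.α 1) • toeplitz L.t₂₁ n)
    (((‖L.α 1‖ ^ 2 : ℝ) : ℂ) • toeplitz L.t₂₂ n)

/-- `log det (I + (2 / m) SNR T^(2n))`. The matrix is Hermitian, so its determinant is real. -/
def logDet (n : ℕ) : ℝ :=
  Real.log
    (1 + (((2 / (numTransmitters : ℝ)) * L.snr : ℝ) : ℂ) • L.blockMatrix n).det.re

/-- Discrete-time Fourier transform `∑ₖ tₖ e^{-ikω}`. -/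
def dtft (t : ℤ → ℂ) (ω : ℝ) : ℂ :=
  ∑' k : ℤ, t k * Complex.exp (-(Complex.I * k * ω))

/-- The matrix symbol `T_E(ω)`. -/
def symbol (ω : ℝ) : Matrix (Fin 2) (Fin 2) ℂ :=
  !![((‖L.α 0‖ ^ 2 : ℝ) : ℂ) * dtft L.t₁₁ ω,
     L.α 0 * starRingEnd ℂ (L.α 1) * dtft L.t₁₂ ω;
     starRingEnd ℂ (L.α 0) * L.α 1 * dtft L.t₂₁ ω,
     ((‖L.α 1‖ ^ 2 : ℝ) : ℂ) * dtft L.t₂₂ ω]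

theorem conj_dtft (t u : ℤ → ℂ) (h : ∀ k, u k = starRingEnd ℂ (t (-k))) (ω : ℝ) :
    starRingEnd ℂ (dtft t ω) = dtft u ω := by
  unfold dtft
  rw [Complex.conj_tsum, ← (Equiv.neg ℤ).tsum_eq]
  refine tsum_congr fun k => ?_
  simp [h, ← Complex.exp_conj]

theorem symbol_isHermitian (ω : ℝ) : (L.symbol ω).IsHermitian := by
  have h11 : starRingEnd ℂ (dtft L.t₁₁ ω) = dtft L.t₁₁ ω := by
    refine conj_dtft _ _ (fun k => ?_) ω
    unfold t₁₁
    split_ifs <;> first | (exfalso; omega) | simp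
  have h22 : starRingEnd ℂ (dtft L.t₂₂ ω) = dtft L.t₂₂ ω := by
    refine conj_dtft _ _ (fun k => ?_) ω
    unfold t₂₂
    split_ifs <;> first | (exfalso; omega) | simp
  have h12 : starRingEnd ℂ (dtft L.t₁₂ ω) = dtft L.t₂₁ ω :=
    conj_dtft _ _ (fun k => rfl) ω
  have h21 : starRingEnd ℂ (dtft L.t₂₁ ω) = dtft L.t₁₂ ω := by
    rw [← h12, Complex.conj_conj]
  ext i j
  fin_cases i <;> fin_cases j <;> simp [symbol, h11, h22, h12, h21]

/-- The `j`-th largest eigenvalue of `T_E(ω)`. -/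
def symbolEigenvalue (ω : ℝ) (j : Fin 2) : ℝ :=
  (L.symbol_isHermitian ω).eigenvalues₀ (Fin.cast (Fintype.card_fin 2).symm j)

/-- `∑ⱼ log (1 + (2 / m) SNR νⱼ(T_E(ω)))`. -/
def rateDensity (ω : ℝ) : ℝ :=
  ∑ j : Fin 2, Real.log (1 + 2 / (numTransmitters : ℝ) * L.snr * L.symbolEigenvalue ω j)

end

end RelayLink

/-! The noise covariance is a multiple of the channel matrix `H` itself, so `H` is positive
semidefinite and a single unitary diagonalizes both. In the eigenbasis the channel splits into
independent scalar channels. An eigenvalue `λ` acts as the gain and scales the noise power, so the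
signal-to-noise ratio is `λ² p / (N λ) = λ p / N`. Each scalar channel is a pair of real ones,
contributing `1/2 log (1 + λ p / N)` each, and the sum is `log det (1 + (p / N) H)`. This is
`mutualInfo_mulVec_add`; it rests on the scalar computation `klDiv_gaussianPair` and on additivity
of the divergence over products. Up to a transpose and a permutation of indices, the channel matrix
is the four-block matrix, so the determinants agree.

The limit is a Szegő theorem for banded block Toeplitz matrices, `tendsto_logDet_blockToeplitz`. The
symbol is positive semidefinite, being a limit of Fejér-type averages of quadratic forms of the
Toeplitz matrices. Sampling it at the `N`-th roots of unity gives a block circulant matrix whose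
log-determinant is exactly a Riemann sum of `log det (1 + γ T(ω))`. With band width `r` and `N = n +
r`, the circulant contains the `n`-block Toeplitz matrix as a corner. The Schur complement of that
corner has bounded size, is at least the identity and has bounded trace (`det_toBlocks₁₁_bounds`),
so the two log-determinants differ by `O(1)`, which disappears after division by `n`. -/

/-! ### Kullback-Leibler divergence: invariance, products, densities. -/

namespace InformationTheory

open scoped ENNReal

variable {α β : Type*} [MeasurableSpace α] [MeasurableSpace β]

/-- The Kullback-Leibler divergence is invariant under measurable maps with a measurable left
inverse. -/
lemma klDiv_map_of_leftInverse {μ ν : Measure α} [IsFiniteMeasure μ] [IsFiniteMeasure ν]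
    {f : α → β} {g : β → α} (hf : Measurable f) (hg : Measurable g)
    (hgf : Function.LeftInverse g f) : klDiv (μ.map f) (ν.map f) = klDiv μ ν := by
  refine le_antisymm (klDiv_map_le μ ν hf) ?_
  have h := klDiv_map_le (μ.map f) (ν.map f) hg
  rwa [Measure.map_map hg hf, Measure.map_map hg hf, hgf.comp_eq_id, Measure.map_id,
    Measure.map_id] at h

/-- The Kullback-Leibler divergence of product probability measures is additive. -/
lemma klDiv_prod (μ₁ ν₁ : Measure α) (μ₂ ν₂ : Measure β) [IsProbabilityMeasure μ₁]
    [IsProbabilityMeasure ν₁] [IsProbabilityMeasure μ₂] [IsProbabilityMeasure ν₂] :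
    klDiv (μ₁.prod μ₂) (ν₁.prod ν₂) = klDiv μ₁ ν₁ + klDiv μ₂ ν₂ := by
  -- The chain rule for constant kernels leaves this divergence as its second term. Swapping the
  -- coordinates makes the common factor `μ₁` the kernel, which then drops out.
  have hswap : klDiv (μ₁.prod μ₂) (μ₁.prod ν₂) = klDiv μ₂ ν₂ := by
    rw [← klDiv_compProd_left μ₂ ν₂ (Kernel.const β μ₁), Measure.compProd_const,
      Measure.compProd_const, ← Measure.prod_swap, ← Measure.prod_swap (μ := ν₂)]
    exact (klDiv_map_of_leftInverse measurable_swap measurable_swap Prod.swap_swap)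
  rw [← hswap, ← Measure.compProd_const, ← Measure.compProd_const, ← Measure.compProd_const]
  exact klDiv_compProd_eq_add _ _ _ _

/-- The Kullback-Leibler divergence of finite products of probability measures is additive. -/
lemma klDiv_pi {ι : Type*} [Fintype ι] (μ ν : ι → Measure α) [∀ i, IsProbabilityMeasure (μ i)]
    [∀ i, IsProbabilityMeasure (ν i)] :
    klDiv (Measure.pi μ) (Measure.pi ν) = ∑ i, klDiv (μ i) (ν i) := by
  revert μ ν
  refine Fintype.induction_empty_option (P := fun ι _ => ∀ (μ ν : ι → Measure α)
    [∀ i, IsProbabilityMeasure (μ i)] [∀ i, IsProbabilityMeasure (ν i)],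
    klDiv (Measure.pi μ) (Measure.pi ν) = ∑ i, klDiv (μ i) (ν i)) ?_ ?_ ?_ ι
  · intro ι κ _ e ih μ ν _ _
    let := Fintype.ofEquiv κ e.symm
    rw [← Measure.pi_map_piCongrLeft e μ, ← Measure.pi_map_piCongrLeft e ν,
      klDiv_map_of_leftInverse (MeasurableEquiv.measurable _)
        (MeasurableEquiv.piCongrLeft (fun _ : κ => α) e).symm.measurable
        (MeasurableEquiv.piCongrLeft (fun _ : κ => α) e).symm_apply_apply,
      ih, e.sum_comp fun i => klDiv (μ i) (ν i)]
  · intro μ ν _ _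
    rw [Measure.pi_of_empty, Measure.pi_of_empty]
    simp
  · intro ι _ ih μ ν _ _
    rw [← Measure.pi_map_piOptionEquivProd μ, ← Measure.pi_map_piOptionEquivProd ν,
      klDiv_map_of_leftInverse (MeasurableEquiv.measurable _)
        (MeasurableEquiv.piOptionEquivProd (fun _ : Option ι => α)).measurable
        (MeasurableEquiv.piOptionEquivProd (fun _ : Option ι => α)).apply_symm_apply,
      klDiv_prod, ih, Fintype.sum_option, add_comm]

/-- The divergence of a measure given by a positive density is the integral of its logarithm. -/
lemma klDiv_eq_of_withDensity {μ ν : Measure α} [IsProbabilityMeasure μ] [IsProbabilityMeasure ν]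
    {f : α → ℝ} (hf : Measurable f) (hμ : μ = ν.withDensity fun x => ENNReal.ofReal (f x))
    (hpos : ∀ x, 0 < f x)
    (hint : Integrable (fun x => Real.log (f x)) μ) :
    klDiv μ ν = ENNReal.ofReal (∫ x, Real.log (f x) ∂μ) := by
  have hac : μ ≪ ν := hμ ▸ withDensity_absolutelyContinuous _ _
  have hllr : llr μ ν =ᵐ[μ] fun x => Real.log (f x) := by
    have h : μ.rnDeriv ν =ᵐ[ν] fun x => ENNReal.ofReal (f x) := by
      rw [hμ]
      exact Measure.rnDeriv_withDensity ν hf.ennreal_ofReal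
    filter_upwards [hac.ae_le h] with x hx
    rw [llr, hx, ENNReal.toReal_ofReal (hpos x).le]
  rw [klDiv_of_ac_of_integrable hac (hint.congr hllr.symm), integral_congr_ae hllr]
  simp

end InformationTheory

/-! ### Invariance of mutual information. -/

section MutualInfo

open InformationTheory

variable {Ω E F E' F' : Type*} [MeasurableSpace Ω] [MeasurableSpace E] [MeasurableSpace F]
  [MeasurableSpace E'] [MeasurableSpace F']

/-- Mutual information is invariant under measurable maps with measurable left inverses. -/
lemma mutualInfo_comp_of_leftInverse (P : Measure Ω) [IsProbabilityMeasure P] {X : Ω → E}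
    {Y : Ω → F} (hX : AEMeasurable X P) (hY : AEMeasurable Y P) {f : E → E'} {f' : E' → E}
    {g : F → F'} {g' : F' → F} (hf : Measurable f) (hf' : Measurable f') (hg : Measurable g)
    (hg' : Measurable g') (hff' : Function.LeftInverse f' f) (hgg' : Function.LeftInverse g' g) :
    mutualInfo P (fun w => f (X w)) (fun w => g (Y w)) = mutualInfo P X Y := by
  have := Measure.isProbabilityMeasure_map hX
  have := Measure.isProbabilityMeasure_map hY
  have := Measure.isProbabilityMeasure_map (hX.prodMk hY)
  have h1 : P.map (fun w => (f (X w), g (Y w))) =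
      (P.map fun w => (X w, Y w)).map (Prod.map f g) := by
    rw [AEMeasurable.map_map_of_aemeasurable (hf.prodMap hg).aemeasurable (hX.prodMk hY)]
    rfl
  have h2 : (P.map fun w => f (X w)).prod (P.map fun w => g (Y w)) =
      ((P.map X).prod (P.map Y)).map (Prod.map f g) := by
    rw [← Measure.map_prod_map _ _ hf hg, AEMeasurable.map_map_of_aemeasurable hf.aemeasurable hX,
      AEMeasurable.map_map_of_aemeasurable hg.aemeasurable hY]
    rfl
  rw [mutualInfo, h1, h2, klDiv_map_of_leftInverse (hf.prodMap hg) (hf'.prodMap hg')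
    (hff'.prodMap hgg')]
  rfl

end MutualInfo

/-! ### The real scalar Gaussian channel. -/

section ScalarGaussian

open InformationTheory
open scoped NNReal

/-- The law of `(cB + Z, B)` for independent centered Gaussians `Z`, `B` of variances `v`, `p`. -/
noncomputable def gaussianPair (c : ℝ) (p v : ℝ≥0) : Measure (ℝ × ℝ) :=
  ((gaussianReal 0 p).prod (gaussianReal 0 v)).map fun x => (c * x.1 + x.2, x.1)

instance (c : ℝ) (p v : ℝ≥0) : IsProbabilityMeasure (gaussianPair c p v) :=
  Measure.isProbabilityMeasure_map (by fun_prop)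

/-- The variance of `cB + Z`. -/
noncomputable def outputVariance (c : ℝ) (p v : ℝ≥0) : ℝ≥0 := NNReal.mk (c ^ 2) (sq_nonneg c) * p + v

lemma gaussianPair_map_fst (c : ℝ) (p v : ℝ≥0) :
    (gaussianPair c p v).map Prod.fst = gaussianReal 0 (outputVariance c p v) := by
  have h : (gaussianReal 0 (NNReal.mk (c ^ 2) (sq_nonneg c) * p)) ∗ (gaussianReal 0 v) =
      gaussianReal 0 (outputVariance c p v) := by
    rw [gaussianReal_conv_gaussianReal, add_zero, outputVariance]
  rw [← h, gaussianPair, Measure.map_map measurable_fst (by fun_prop), Measure.conv]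
  have h2 := gaussianReal_map_const_mul (μ := 0) (v := p) c
  rw [mul_zero] at h2
  rw [← h2, ← Measure.map_id (μ := gaussianReal 0 v), Measure.map_prod_map _ _ (by fun_prop)
    (by fun_prop), Measure.map_id, Measure.map_map (by fun_prop) (by fun_prop)]
  rfl

/-- The likelihood ratio of `(cB + Z, B)` with respect to independent variables. -/
noncomputable def gaussianRatio (c : ℝ) (p v : ℝ≥0) (x : ℝ × ℝ) : ℝ :=
  gaussianPDFReal (c * x.2) v x.1 / gaussianPDFReal 0 (outputVariance c p v) x.1

lemma measurable_gaussianRatio (c : ℝ) (p v : ℝ≥0) : Measurable (gaussianRatio c p v) := by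
  unfold gaussianRatio
  simp only [gaussianPDFReal]
  fun_prop

lemma outputVariance_ne_zero (c : ℝ) (p : ℝ≥0) {v : ℝ≥0} (hv : v ≠ 0) :
    outputVariance c p v ≠ 0 := by
  simp [outputVariance, hv]

/-- Given `B = b` the output has law `gaussianReal (c * b) v`, so after integrating over `b` last it
suffices to compare this density with that of the output marginal. Both exist because `v ≠ 0`. -/
lemma gaussianPair_eq_withDensity (c : ℝ) (p : ℝ≥0) {v : ℝ≥0} (hv : v ≠ 0) :
    gaussianPair c p v = ((gaussianReal 0 (outputVariance c p v)).prod
      (gaussianReal 0 p)).withDensity fun x => ENNReal.ofReal (gaussianRatio c p v x) := by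
  have hs := outputVariance_ne_zero c p hv
  have hm : Measurable fun x => ENNReal.ofReal (gaussianRatio c p v x) :=
    (measurable_gaussianRatio c p v).ennreal_ofReal
  refine Measure.ext_of_lintegral _ fun g hg => ?_
  rw [lintegral_withDensity_eq_lintegral_mul _ hm hg, gaussianPair,
    lintegral_map hg (by fun_prop), lintegral_prod _ (by fun_prop),
    lintegral_prod_symm _ (by fun_prop)]
  refine lintegral_congr fun b => ?_
  have h1 : ∫⁻ z, g (c * b + z, b) ∂(gaussianReal 0 v) =
      ∫⁻ y, g (y, b) ∂(gaussianReal (c * b) v) := by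
    have h := gaussianReal_map_const_add (μ := 0) (v := v) (c * b)
    rw [zero_add] at h
    rw [← h, lintegral_map (by fun_prop) (by fun_prop)]
  rw [h1, gaussianReal_of_var_ne_zero _ hv, gaussianReal_of_var_ne_zero _ hs,
    lintegral_withDensity_eq_lintegral_mul _ (measurable_gaussianPDF _ _) (by fun_prop),
    lintegral_withDensity_eq_lintegral_mul _ (measurable_gaussianPDF _ _) (by fun_prop)]
  refine lintegral_congr fun y => ?_
  simp only [Pi.mul_apply]
  rw [← mul_assoc]
  congr 1
  rw [gaussianPDF, gaussianPDF, ← ENNReal.ofReal_mul (gaussianPDFReal_nonneg _ _ _), gaussianRatio,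
    mul_div_cancel₀ _ (gaussianPDFReal_pos _ _ _ hs).ne']

lemma log_gaussianRatio (c : ℝ) (p : ℝ≥0) {v : ℝ≥0} (hv : v ≠ 0) (x : ℝ × ℝ) :
    Real.log (gaussianRatio c p v x) =
      1 / 2 * Real.log (outputVariance c p v / v) - (x.1 - c * x.2) ^ 2 / (2 * v) +
        x.1 ^ 2 / (2 * outputVariance c p v) := by
  have hs := outputVariance_ne_zero c p hv
  have hs' : (0 : ℝ) < outputVariance c p v := by positivity
  have hv' : (0 : ℝ) < v := by positivity
  have hpi := Real.pi_pos
  rw [gaussianRatio, Real.log_div (gaussianPDFReal_pos _ _ _ hv).ne'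
    (gaussianPDFReal_pos _ _ _ hs).ne', gaussianPDFReal, gaussianPDFReal,
    Real.log_mul (by positivity) (by positivity), Real.log_mul (by positivity) (by positivity),
    Real.log_exp, Real.log_exp, Real.log_inv, Real.log_inv, Real.log_sqrt (by positivity),
    Real.log_sqrt (by positivity), Real.log_mul (by positivity) hv'.ne',
    Real.log_mul (by positivity) hs'.ne', Real.log_div hs'.ne' hv'.ne']
  ring

lemma integrable_sq_gaussianReal (v : ℝ≥0) : Integrable (fun x => x ^ 2) (gaussianReal 0 v) :=
  (memLp_id_gaussianReal' 2 (by simp)).integrable_sq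

lemma integral_sq_gaussianReal (v : ℝ≥0) : ∫ x, x ^ 2 ∂(gaussianReal 0 v) = v := by
  have h := variance_id_gaussianReal (μ := 0) (v := v)
  rw [variance_eq_sub (memLp_id_gaussianReal' 2 (by simp))] at h
  simpa using h

/-- The information about a centered Gaussian of variance `p` in its observation, scaled by `c`,
through centered Gaussian noise of variance `v`. -/
lemma klDiv_gaussianPair (c : ℝ) (p : ℝ≥0) {v : ℝ≥0} (hv : v ≠ 0) :
    klDiv (gaussianPair c p v) ((gaussianReal 0 (outputVariance c p v)).prod (gaussianReal 0 p)) =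
      ENNReal.ofReal (1 / 2 * Real.log (1 + c ^ 2 * p / v)) := by
  have hs := outputVariance_ne_zero c p hv
  have hs' : (0 : ℝ) < outputVariance c p v := by positivity
  have hv' : (0 : ℝ) < v := by positivity
  -- Subtracting the signal recovers the noise, so the two quadratic terms of the log-ratio have
  -- means `v` and `outputVariance c p v`. After normalization they cancel as `-1/2 + 1/2`, leaving
  -- only the logarithm.
  have hm : (gaussianPair c p v).map (fun x => x.1 - c * x.2) = gaussianReal 0 v := by
    rw [gaussianPair, Measure.map_map (by fun_prop) (by fun_prop)]
    have : (fun x : ℝ × ℝ => x.1 - c * x.2) ∘ (fun x : ℝ × ℝ => (c * x.1 + x.2, x.1)) =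
        Prod.snd := by
      ext x
      simp
    rw [this, Measure.map_snd_prod]
    simp
  have hi1 : Integrable (fun x : ℝ × ℝ => (x.1 - c * x.2) ^ 2) (gaussianPair c p v) := by
    have h := integrable_sq_gaussianReal v
    rw [← hm] at h
    exact (integrable_map_measure (by fun_prop) (by fun_prop)).1 h
  have hi2 : Integrable (fun x : ℝ × ℝ => x.1 ^ 2) (gaussianPair c p v) := by
    have h := integrable_sq_gaussianReal (outputVariance c p v)
    rw [← gaussianPair_map_fst] at h
    exact (integrable_map_measure (by fun_prop) (by fun_prop)).1 h
  have he1 : ∫ x : ℝ × ℝ, (x.1 - c * x.2) ^ 2 ∂(gaussianPair c p v) = v := by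
    rw [← integral_sq_gaussianReal v, ← hm, integral_map (by fun_prop) (by fun_prop)]
  have he2 : ∫ x : ℝ × ℝ, x.1 ^ 2 ∂(gaussianPair c p v) = outputVariance c p v := by
    rw [← integral_sq_gaussianReal (outputVariance c p v), ← gaussianPair_map_fst,
      integral_map (by fun_prop) (by fun_prop)]
  have hi3 : Integrable (fun x : ℝ × ℝ => 1 / 2 * Real.log (outputVariance c p v / v) -
      (x.1 - c * x.2) ^ 2 / (2 * v)) (gaussianPair c p v) :=
    (integrable_const _).sub (hi1.div_const _)
  rw [klDiv_eq_of_withDensity (measurable_gaussianRatio c p v) (gaussianPair_eq_withDensity c p hv)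
    (fun x => div_pos (gaussianPDFReal_pos _ _ _ hv) (gaussianPDFReal_pos _ _ _ hs))]
  · simp only [log_gaussianRatio c p hv]
    rw [integral_add hi3 (hi2.div_const _), integral_sub (integrable_const _) (hi1.div_const _),
      integral_div, integral_div, he1, he2]
    have : (outputVariance c p v : ℝ) / v = 1 + c ^ 2 * p / v := by
      simp only [outputVariance, NNReal.coe_add, NNReal.coe_mul, NNReal.coe_mk]
      field_simp
      ring
    simp only [integral_const, probReal_univ, one_smul, this]
    congr 1
    field_simp
    ring
  · simp only [log_gaussianRatio c p hv]
    exact hi3.add (hi2.div_const _)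

/-- The information vanishes when the observation is identically zero. -/
lemma klDiv_gaussianPair_zero (p : ℝ≥0) :
    klDiv (gaussianPair 0 p 0) ((gaussianReal 0 (outputVariance 0 p 0)).prod (gaussianReal 0 p)) =
      0 := by
  have h : gaussianPair 0 p 0 = (gaussianReal 0 (outputVariance 0 p 0)).prod (gaussianReal 0 p) := by
    have h0 : outputVariance 0 p 0 = 0 := by
      ext
      simp [outputVariance]
    have hf : (fun x : ℝ × ℝ => (0 * x.1 + x.2, x.1)) = Prod.swap := by
      ext x <;> simp
    rw [gaussianPair, h0, hf, Measure.prod_swap]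
  rw [h, klDiv_self]

end ScalarGaussian

/-! ### Parallel real channels and uncorrelated Gaussian coordinates. -/

section RealVectorGaussian

open InformationTheory
open scoped NNReal

variable {Ω κ : Type*} [MeasurableSpace Ω] [Fintype κ] {P : Measure Ω}

/-- The mutual information across parallel independent Gaussian channels is the sum of the
individual ones. -/
lemma mutualInfo_parallel_gaussian [IsProbabilityMeasure P] {B Z : Ω → κ → ℝ}
    (c : κ → ℝ) (p v : κ → ℝ≥0) (mB : AEMeasurable B P) (mZ : AEMeasurable Z P)
    (hB : P.map B = Measure.pi fun k => gaussianReal 0 (p k))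
    (hZ : P.map Z = Measure.pi fun k => gaussianReal 0 (v k)) (hBZ : IndepFun B Z P) :
    mutualInfo P (fun w k => c k * B w k + Z w k) B =
      ∑ k, klDiv (gaussianPair (c k) (p k) (v k))
        ((gaussianReal 0 (outputVariance (c k) (p k) (v k))).prod (gaussianReal 0 (p k))) := by
  have mY : AEMeasurable (fun w k => c k * B w k + Z w k) P := by fun_prop
  have he := fun μ ν : κ → Measure ℝ => fun (_ : ∀ k, IsProbabilityMeasure (μ k))
    (_ : ∀ k, IsProbabilityMeasure (ν k)) =>
    (measurePreserving_arrowProdEquivProdArrow ℝ ℝ κ μ ν).map_eq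
  -- Regrouping a vector of pairs as a pair of vectors exhibits both the joint law and the product
  -- of the marginals as images under `e` of product measures, to which additivity of the divergence
  -- applies.
  set e := MeasurableEquiv.arrowProdEquivProdArrow ℝ ℝ κ with he_def
  have hjoint : P.map (fun w => ((fun k => c k * B w k + Z w k), B w)) =
      (Measure.pi fun k => gaussianPair (c k) (p k) (v k)).map e := by
    have h1 : P.map (fun w => (B w, Z w)) =
        (Measure.pi fun k => (gaussianReal 0 (p k)).prod (gaussianReal 0 (v k))).map e := by
      rw [hBZ.map_prod_eq_prod_map_map mB mZ, hB, hZ, he _ _ inferInstance inferInstance]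
    have h2 : P.map (fun w => ((fun k => c k * B w k + Z w k), B w)) =
        (P.map (fun w => (B w, Z w))).map
          (fun x : (κ → ℝ) × (κ → ℝ) => ((fun k => c k * x.1 k + x.2 k), x.1)) := by
      rw [AEMeasurable.map_map_of_aemeasurable (by fun_prop) (mB.prodMk mZ)]
      rfl
    have h3 : (Measure.pi fun k => gaussianPair (c k) (p k) (v k)) =
        (Measure.pi fun k => (gaussianReal 0 (p k)).prod (gaussianReal 0 (v k))).map
          (fun x k => (c k * (x k).1 + (x k).2, (x k).1)) := by
      have : ∀ k, SigmaFinite (((gaussianReal 0 (p k)).prod (gaussianReal 0 (v k))).map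
          fun x => (c k * x.1 + x.2, x.1)) := fun k =>
        inferInstanceAs (SigmaFinite (gaussianPair (c k) (p k) (v k)))
      rw [Measure.pi_map_pi (μ := fun k => (gaussianReal 0 (p k)).prod
        (gaussianReal 0 (v k))) (f := fun k (x : ℝ × ℝ) => (c k * x.1 + x.2, x.1))
        (fun k => by fun_prop)]
      rfl
    rw [h2, h1, h3, Measure.map_map (by fun_prop) e.measurable,
      Measure.map_map e.measurable (by fun_prop)]
    rfl
  have hY : P.map (fun w k => c k * B w k + Z w k) =
      Measure.pi fun k => gaussianReal 0 (outputVariance (c k) (p k) (v k)) := by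
    have h1 : P.map (fun w k => c k * B w k + Z w k) =
        (P.map (fun w => ((fun k => c k * B w k + Z w k), B w))).map Prod.fst := by
      rw [AEMeasurable.map_map_of_aemeasurable (by fun_prop) (mY.prodMk mB)]
      rfl
    have : ∀ k, SigmaFinite ((gaussianPair (c k) (p k) (v k)).map Prod.fst) := fun k => by
      rw [gaussianPair_map_fst]
      infer_instance
    rw [h1, hjoint, Measure.map_map (by fun_prop) e.measurable]
    simp only [← gaussianPair_map_fst]
    rw [← Measure.pi_map_pi (fun k => by fun_prop)]
    rfl
  rw [mutualInfo, hjoint, hY, hB, ← he _ _ inferInstance inferInstance,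
    klDiv_map_of_leftInverse e.measurable e.symm.measurable e.symm_apply_apply, klDiv_pi]

/-- A centered Gaussian vector with uncorrelated coordinates has independent coordinates. -/
lemma ProbabilityTheory.HasGaussianLaw.map_eq_pi_of_uncorrelated {X : Ω → κ → ℝ} (hX : HasGaussianLaw X P)
    (v : κ → ℝ≥0) (hmean : ∀ k, ∫ w, X w k ∂P = 0)
    (hvar : ∀ k, ∫ w, X w k * X w k ∂P = v k)
    (hcov : ∀ k l, k ≠ l → ∫ w, X w k * X w l ∂P = 0) :
    P.map X = Measure.pi fun k => gaussianReal 0 (v k) := by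
  have := hX.isProbabilityMeasure
  have hX' : HasGaussianLaw (fun ω ↦ ((fun k w => X w k) · ω)) P := hX
  have hk : ∀ k, HasGaussianLaw (fun w => X w k) P := fun k => hX'.eval k
  have hind : iIndepFun (fun k w => X w k) P := by
    refine hX'.iIndepFun_of_covariance_eq_zero fun k l hkl => ?_
    simpa [covariance, hmean] using hcov k l hkl
  have h := hind.map_fun_eq_pi_map fun k => (hk k).aemeasurable
  rw [show X = fun w k => X w k from rfl, h]
  congr 1
  funext k
  rw [(hk k).map_eq_gaussianReal, hmean, variance_eq_sub (hk k).memLp_two]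
  congr 1
  have : ∫ w, ((fun w => X w k) ^ 2) w ∂P = v k := by
    simpa [pow_two] using hvar k
  rw [this, hmean]
  simp

end RealVectorGaussian

/-! ### Proper complex Gaussian vectors and the channel with matched noise. -/

section ComplexGaussian

open Matrix InformationTheory
open scoped NNReal ComplexOrder

variable {Ω ι κ : Type*} [MeasurableSpace Ω] {P : Measure Ω}

namespace IsProperComplexGaussian

variable [Fintype ι] {X : Ω → ι → ℂ} {S : Matrix ι ι ℂ}

lemma memLp_eval (hX : IsProperComplexGaussian P X S) (i : ι) : MemLp (fun w => X w i) 2 P :=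
  memLp_pi_iff.1 hX.gaussian.memLp_two i

lemma integrable_eval (hX : IsProperComplexGaussian P X S) (i : ι) :
    Integrable (fun w => X w i) P :=
  have := hX.gaussian.isProbabilityMeasure
  (hX.memLp_eval i).integrable (by norm_num)

lemma integrable_mul (hX : IsProperComplexGaussian P X S) (i j : ι) :
    Integrable (fun w => X w i * X w j) P :=
  (hX.memLp_eval i).integrable_mul (hX.memLp_eval j)

lemma integrable_mul_conj (hX : IsProperComplexGaussian P X S) (i j : ι) :
    Integrable (fun w => X w i * starRingEnd ℂ (X w j)) P :=
  (hX.memLp_eval i).integrable_mul (hX.memLp_eval j).star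

/-- Linear images of proper complex Gaussian vectors are proper complex Gaussian. -/
lemma mulVec [Fintype κ] (hX : IsProperComplexGaussian P X S) (A : Matrix κ ι ℂ) :
    IsProperComplexGaussian P (fun w => A *ᵥ X w) (A * S * Aᴴ) where
  gaussian := hX.gaussian.map_fun (A.mulVecLin.restrictScalars ℝ).toContinuousLinearMap
  mean k := by
    simp only [Matrix.mulVec, dotProduct]
    rw [integral_finsetSum _ fun i _ => (hX.integrable_eval i).const_mul _]
    simp [integral_const_mul, hX.mean]
  covariance k l := by
    simp only [Matrix.mulVec, dotProduct, map_sum, map_mul]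
    simp only [Finset.sum_mul_sum]
    have h : ∀ i j, Integrable (fun w => A k i * X w i *
        (starRingEnd ℂ (A l j) * starRingEnd ℂ (X w j))) P := fun i j => by
      refine ((hX.integrable_mul_conj i j).const_mul (A k i * starRingEnd ℂ (A l j))).congr
        (.of_forall fun w => ?_)
      simp only
      ring
    rw [integral_finsetSum _ fun i _ => integrable_finsetSum _ fun j _ => h i j]
    simp only [Matrix.mul_apply, conjTranspose_apply, Finset.sum_mul]
    rw [Finset.sum_comm]
    refine Finset.sum_congr rfl fun i _ => ?_
    rw [integral_finsetSum _ fun j _ => h i j]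
    refine Finset.sum_congr rfl fun j _ => ?_
    rw [← hX.covariance, ← integral_const_mul, ← integral_mul_const]
    refine integral_congr_ae (.of_forall fun w => ?_)
    simp only [Complex.star_def]
    ring
  pseudoCovariance k l := by
    simp only [Matrix.mulVec, dotProduct, Finset.sum_mul_sum]
    have h : ∀ i j, Integrable (fun w => A k i * X w i * (A l j * X w j)) P := fun i j => by
      refine ((hX.integrable_mul i j).const_mul (A k i * A l j)).congr (.of_forall fun w => ?_)
      simp only
      ring
    rw [integral_finsetSum _ fun i _ => integrable_finsetSum _ fun j _ => h i j]
    refine Finset.sum_eq_zero fun i _ => ?_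
    rw [integral_finsetSum _ fun j _ => h i j]
    refine Finset.sum_eq_zero fun j _ => ?_
    rw [show (fun w => A k i * X w i * (A l j * X w j)) =
      fun w => A k i * A l j * (X w i * X w j) by funext w; ring, integral_const_mul,
      hX.pseudoCovariance, mul_zero]

/-- The covariance matrix of a proper complex Gaussian vector is positive semidefinite. -/
lemma posSemidef (hX : IsProperComplexGaussian P X S) : S.PosSemidef := by
  refine PosSemidef.of_dotProduct_mulVec_nonneg ?_ fun x => ?_
  · ext i j
    rw [conjTranspose_apply, ← hX.covariance, ← hX.covariance, Complex.star_def, ← integral_conj]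
    simp [mul_comm]
  -- The quadratic form at `x` is the second absolute moment of the scalar `star x ⬝ᵥ X`.
  · have h := (hX.mulVec (Matrix.of fun (_ : Unit) i => star (x i))).covariance () ()
    have h2 : (Matrix.of (fun (_ : Unit) i => star (x i)) * S *
        (Matrix.of fun (_ : Unit) i => star (x i))ᴴ) () () = star x ⬝ᵥ S *ᵥ x := by
      rw [Matrix.mul_assoc]
      simp [Matrix.mul_apply, dotProduct, Matrix.mulVec]
    rw [← h2, ← h]
    simp only [Complex.mul_conj]
    rw [integral_complex_ofReal]
    exact_mod_cast integral_nonneg fun w => Complex.normSq_nonneg _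

end IsProperComplexGaussian

/-- The real and imaginary parts of a complex vector. -/
def realCoords (x : ι → ℂ) : ι ⊕ ι → ℝ := Sum.elim (fun i => (x i).re) (fun i => (x i).im)

/-- The complex vector with given real and imaginary parts. -/
def ofRealCoords (y : ι ⊕ ι → ℝ) (i : ι) : ℂ := ⟨y (.inl i), y (.inr i)⟩

lemma ofRealCoords_realCoords : Function.LeftInverse (ofRealCoords (ι := ι)) realCoords :=
  fun _ => rfl

lemma measurable_ofRealCoords : Measurable (ofRealCoords (ι := ι)) := by
  refine measurable_pi_lambda _ fun i => ?_
  have : (fun y : ι ⊕ ι → ℝ => ofRealCoords y i) =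
      fun y => (y (.inl i) : ℂ) + (y (.inr i) : ℂ) * Complex.I := by
    funext y
    apply Complex.ext <;> simp [ofRealCoords]
  rw [this]
  fun_prop

variable [Fintype ι]

/-- `realCoords` as a continuous real-linear map. -/
noncomputable def realCoordsCLM : (ι → ℂ) →L[ℝ] (ι ⊕ ι → ℝ) :=
  LinearMap.toContinuousLinearMap
    { toFun := realCoords
      map_add' := fun x y => by ext k; cases k <;> simp [realCoords]
      map_smul' := fun r x => by ext k; cases k <;> simp [realCoords] }

lemma measurable_realCoords : Measurable (realCoords (ι := ι)) :=
  (realCoordsCLM (ι := ι)).measurable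

/-- The real coordinates of a proper complex Gaussian vector with diagonal covariance are
independent. -/
lemma IsProperComplexGaussian.map_realCoords [DecidableEq ι] {X : Ω → ι → ℂ} {d : ι → ℝ≥0}
    (hX : IsProperComplexGaussian P X (diagonal fun i => ((d i : ℝ) : ℂ))) :
    P.map (fun w => realCoords (X w)) =
      Measure.pi fun k => gaussianReal 0 (Sum.elim (fun i => d i / 2) (fun i => d i / 2) k) := by
  have ire : ∀ i j, Integrable (fun w => (X w i * X w j).re) P := fun i j =>
    (hX.integrable_mul i j).re
  have iim : ∀ i j, Integrable (fun w => (X w i * X w j).im) P := fun i j =>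
    (hX.integrable_mul i j).im
  have ire' : ∀ i j, Integrable (fun w => (X w i * starRingEnd ℂ (X w j)).re) P := fun i j =>
    (hX.integrable_mul_conj i j).re
  have iim' : ∀ i j, Integrable (fun w => (X w i * starRingEnd ℂ (X w j)).im) P := fun i j =>
    (hX.integrable_mul_conj i j).im
  have hre : ∀ i j, ∫ w, (X w i * X w j).re ∂P = 0 := fun i j =>
    (integral_re (hX.integrable_mul i j)).trans (by simp [hX.pseudoCovariance i j])
  have him : ∀ i j, ∫ w, (X w i * X w j).im ∂P = 0 := fun i j =>
    (integral_im (hX.integrable_mul i j)).trans (by simp [hX.pseudoCovariance i j])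
  have hre' : ∀ i j, ∫ w, (X w i * starRingEnd ℂ (X w j)).re ∂P = if i = j then (d i : ℝ) else 0 :=
    fun i j => (integral_re (hX.integrable_mul_conj i j)).trans (by
      rw [hX.covariance i j, diagonal_apply]; split_ifs <;> simp)
  have him' : ∀ i j, ∫ w, (X w i * starRingEnd ℂ (X w j)).im ∂P = 0 :=
    fun i j => (integral_im (hX.integrable_mul_conj i j)).trans (by
      rw [hX.covariance i j, diagonal_apply]; split_ifs <;> simp)
  -- Real second moments are half sums or differences of parts of the covariance and the
  -- pseudo-covariance. The latter vanishes, so the variance `d i` splits equally between real and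
  -- imaginary part.
  have hrr : ∀ i j, ∫ w, (X w i).re * (X w j).re ∂P = if i = j then (d i : ℝ) / 2 else 0 := by
    intro i j
    have : (fun w => (X w i).re * (X w j).re) = fun w =>
        ((X w i * X w j).re + (X w i * starRingEnd ℂ (X w j)).re) / 2 := by
      funext w; simp only [Complex.mul_re, Complex.conj_re, Complex.conj_im]; ring
    rw [this, integral_div, integral_add (ire i j) (ire' i j), hre, hre']
    split_ifs <;> simp
  have hii : ∀ i j, ∫ w, (X w i).im * (X w j).im ∂P = if i = j then (d i : ℝ) / 2 else 0 := by
    intro i j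
    have : (fun w => (X w i).im * (X w j).im) = fun w =>
        ((X w i * starRingEnd ℂ (X w j)).re - (X w i * X w j).re) / 2 := by
      funext w; simp only [Complex.mul_re, Complex.conj_re, Complex.conj_im]; ring
    rw [this, integral_div, integral_sub (ire' i j) (ire i j), hre, hre']
    split_ifs <;> simp
  have hri : ∀ i j, ∫ w, (X w i).re * (X w j).im ∂P = 0 := by
    intro i j
    have : (fun w => (X w i).re * (X w j).im) = fun w =>
        ((X w i * X w j).im - (X w i * starRingEnd ℂ (X w j)).im) / 2 := by
      funext w; simp only [Complex.mul_im, Complex.conj_re, Complex.conj_im]; ring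
    rw [this, integral_div, integral_sub (iim i j) (iim' i j), him, him']
    simp
  have hir : ∀ i j, ∫ w, (X w i).im * (X w j).re ∂P = 0 := by
    intro i j
    simpa [mul_comm] using hri j i
  refine HasGaussianLaw.map_eq_pi_of_uncorrelated (hX.gaussian.map_fun realCoordsCLM) _ ?_ ?_ ?_
  · rintro (i | i)
    · exact (integral_re (hX.integrable_eval i)).trans (by simp [hX.mean])
    · exact (integral_im (hX.integrable_eval i)).trans (by simp [hX.mean])
  · rintro (i | i)
    · exact (hrr i i).trans (by simp)
    · exact (hii i i).trans (by simp)
  · rintro (i | i) (j | j) hij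
    · exact (hrr i j).trans (if_neg fun h => hij (congrArg _ h))
    · exact hri i j
    · exact hir i j
    · exact (hii i j).trans (if_neg fun h => hij (congrArg _ h))

lemma Matrix.IsHermitian.exists_unitary_diagonalization [DecidableEq ι] {H : Matrix ι ι ℂ}
    (hH : H.IsHermitian) : ∃ U : Matrix ι ι ℂ, Uᴴ * U = 1 ∧ U * Uᴴ = 1 ∧
      Uᴴ * H * U = diagonal fun i => (hH.eigenvalues i : ℂ) := by
  refine ⟨(hH.eigenvectorUnitary : Matrix ι ι ℂ), Unitary.coe_star_mul_self hH.eigenvectorUnitary,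
    Unitary.coe_mul_star_self hH.eigenvectorUnitary, ?_⟩
  have h := hH.conjStarAlgAut_star_eigenvectorUnitary
  rw [Unitary.conjStarAlgAut_star_apply] at h
  exact h

/-- Conjugation by the eigenvector unitary preserves the determinant. The product form shows that
the determinant is real, so taking `.re` before a logarithm loses nothing. -/
lemma Matrix.IsHermitian.det_one_add_smul [DecidableEq ι] {H : Matrix ι ι ℂ} (hH : H.IsHermitian)
    (γ : ℝ) : (1 + (γ : ℂ) • H).det = ((∏ i, (1 + γ * hH.eigenvalues i) : ℝ) : ℂ) := by
  obtain ⟨U, hUU, hUU', hD⟩ := hH.exists_unitary_diagonalization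
  have h1 : Uᴴ * (1 + (γ : ℂ) • H) * U = diagonal fun i => (1 + γ * hH.eigenvalues i : ℂ) := by
    rw [Matrix.mul_add, Matrix.add_mul, Matrix.mul_one, hUU, Matrix.mul_smul, Matrix.smul_mul, hD,
      ← diagonal_one, ← diagonal_smul, diagonal_add]
    rfl
  have h2 := congrArg det h1
  rw [Matrix.mul_assoc, det_mul_comm, Matrix.mul_assoc, hUU', Matrix.mul_one, det_diagonal] at h2
  rw [h2]
  push_cast
  rfl

/-- The mutual information of a linear Gaussian channel whose noise is shaped by the channel
matrix itself, `y = Hb + z` with white input `b` of power `p` and noise covariance `N • H`. -/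
theorem mutualInfo_mulVec_add [DecidableEq ι] {b z : Ω → ι → ℂ} {H : Matrix ι ι ℂ}
    (hH : H.PosSemidef) {p N : ℝ} (hp : 0 < p) (hN : 0 < N)
    (hb : IsProperComplexGaussian P b ((p : ℂ) • 1))
    (hz : IsProperComplexGaussian P z ((N : ℂ) • H)) (hbz : IndepFun b z P) :
    mutualInfo P (fun w => H *ᵥ b w + z w) b =
      ENNReal.ofReal (Real.log (1 + ((p / N : ℝ) : ℂ) • H).det.re) := by
  have := hb.gaussian.isProbabilityMeasure
  obtain ⟨U, hUU, hUU', hD⟩ := hH.1.exists_unitary_diagonalization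
  let d : ι → ℝ≥0 := fun i => ⟨hH.1.eigenvalues i, hH.eigenvalues_nonneg i⟩
  have hd : ∀ i, (d i : ℝ) = hH.1.eigenvalues i := fun i => rfl
  let p' : ℝ≥0 := ⟨p, hp.le⟩
  let N' : ℝ≥0 := ⟨N, hN.le⟩
  have hp' : (p' : ℝ) = p := rfl
  have hN' : (N' : ℝ) = N := rfl
  have mb := hb.gaussian.aemeasurable
  have mz := hz.gaussian.aemeasurable
  have my : AEMeasurable (fun w => H *ᵥ b w + z w) P :=
    ((hb.mulVec H).gaussian.aemeasurable).add mz
  have mU : ∀ A : Matrix ι ι ℂ, Measurable fun x : ι → ℂ => A *ᵥ x := fun A =>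
    (A.mulVecLin.toContinuousLinearMap).measurable
  -- The same rotation into the eigenbasis is applied to input and output. It is invertible, keeps
  -- the input white and makes the noise coordinates independent.
  let f : (ι → ℂ) → (ι ⊕ ι → ℝ) := fun x => realCoords (Uᴴ *ᵥ x)
  have mf : Measurable f := measurable_realCoords.comp (mU _)
  have hf : Function.LeftInverse (fun y => U *ᵥ ofRealCoords y) f := fun x => by
    simp only [f]
    rw [ofRealCoords_realCoords, mulVec_mulVec, hUU', one_mulVec]
  have mf' : Measurable fun y : ι ⊕ ι → ℝ => U *ᵥ ofRealCoords y :=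
    (mU U).comp measurable_ofRealCoords
  rw [← mutualInfo_comp_of_leftInverse P my mb mf mf' mf mf' hf hf]
  have hfy : (fun w => f (H *ᵥ b w + z w)) = fun w k =>
      Sum.elim (fun i => (d i : ℝ)) (fun i => (d i : ℝ)) k * f (b w) k + f (z w) k := by
    funext w k
    have h1 : Uᴴ *ᵥ (H *ᵥ b w + z w) =
        (diagonal fun i => (hH.1.eigenvalues i : ℂ)) *ᵥ (Uᴴ *ᵥ b w) + Uᴴ *ᵥ z w := by
      rw [← hD, mulVec_mulVec, Matrix.mul_assoc, hUU', Matrix.mul_one, mulVec_add, mulVec_mulVec]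
    simp only [f, h1]
    generalize Uᴴ *ᵥ b w = x
    cases k <;> simp [realCoords, mulVec_diagonal, hd]
  have lb : P.map (fun w => f (b w)) = Measure.pi fun k =>
      gaussianReal 0 (Sum.elim (fun _ => p' / 2) (fun _ => p' / 2) k) := by
    refine IsProperComplexGaussian.map_realCoords (d := fun _ => p') ?_
    convert hb.mulVec Uᴴ using 1
    rw [conjTranspose_conjTranspose, Matrix.mul_smul, Matrix.smul_mul, Matrix.mul_one, hUU,
      smul_one_eq_diagonal]
    rfl
  have lz : P.map (fun w => f (z w)) = Measure.pi fun k =>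
      gaussianReal 0 (Sum.elim (fun i => N' * d i / 2) (fun i => N' * d i / 2) k) := by
    refine IsProperComplexGaussian.map_realCoords (d := fun i => N' * d i) ?_
    convert hz.mulVec Uᴴ using 1
    rw [conjTranspose_conjTranspose, Matrix.mul_smul, Matrix.smul_mul, hD, ← diagonal_smul]
    congr 1
    funext i
    simp [hd, hN']
  rw [hfy, mutualInfo_parallel_gaussian (B := fun w => f (b w)) (Z := fun w => f (z w)) _ _ _
    (mf.comp_aemeasurable mb) (mf.comp_aemeasurable mz)
    lb lz (hbz.comp mf mf), Fintype.sum_sum_type]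
  have hterm : ∀ i, klDiv (gaussianPair (d i) (p' / 2) (N' * d i / 2))
      ((gaussianReal 0 (outputVariance (d i) (p' / 2) (N' * d i / 2))).prod
        (gaussianReal 0 (p' / 2))) =
      ENNReal.ofReal (1 / 2 * Real.log (1 + p / N * hH.1.eigenvalues i)) := by
    intro i
    -- At a zero eigenvalue the noise has no density, but the gain vanishes too: the output is zero
    -- and carries no information, in agreement with `log 1 = 0`.
    by_cases h0 : d i = 0
    · have h0' : hH.1.eigenvalues i = 0 := by rw [← hd, h0]; rfl
      rw [h0, h0']
      simpa using klDiv_gaussianPair_zero (p' / 2)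
    · have hv : N' * d i / 2 ≠ 0 := by
        have : N' ≠ 0 := fun h => hN.ne' (congrArg NNReal.toReal h)
        positivity
      have h0' : (hH.1.eigenvalues i) ≠ 0 := fun h => h0 (NNReal.eq h)
      -- With gain `λ`, the ratio is `λ² (p / 2) / (N λ / 2) = (p / N) λ`.
      rw [klDiv_gaussianPair _ _ hv]
      congr 4
      push_cast
      rw [hd, hp', hN']
      field_simp
  have hpos : ∀ i, 1 ≤ 1 + p / N * hH.1.eigenvalues i := fun i =>
    le_add_of_nonneg_right (mul_nonneg (div_nonneg hp.le hN.le) (hH.eigenvalues_nonneg i))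
  have hlog : ∀ i, 0 ≤ 1 / 2 * Real.log (1 + p / N * hH.1.eigenvalues i) := fun i =>
    mul_nonneg (by norm_num) (Real.log_nonneg (hpos i))
  simp only [Sum.elim_inl, Sum.elim_inr, hterm]
  rw [← ENNReal.ofReal_sum_of_nonneg fun i _ => hlog i,
    ← ENNReal.ofReal_add (Finset.sum_nonneg fun i _ => hlog i)
      (Finset.sum_nonneg fun i _ => hlog i), hH.1.det_one_add_smul, Complex.ofReal_re,
    Real.log_prod fun i _ => (one_pos.trans_le (hpos i)).ne', ← Finset.mul_sum]
  congr 1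
  ring

end ComplexGaussian

/-! ### Determinants of matrices bounded below by the identity. -/

section SchurComplement

open Matrix
open scoped ComplexOrder

variable {m k : Type*} [DecidableEq m] [DecidableEq k]

lemma Matrix.PosSemidef.posDef_of_sub_one {S : Matrix k k ℂ} (h : (S - 1).PosSemidef) :
    S.PosDef := by
  simpa using Matrix.PosDef.one.add_posSemidef h

variable [Fintype m] [Fintype k]

/-- Evaluate the quadratic form of `S - 1` at a unit eigenvector. -/
lemma Matrix.IsHermitian.one_le_eigenvalues {S : Matrix k k ℂ} (hS : S.IsHermitian)
    (h : (S - 1).PosSemidef) (i : k) : 1 ≤ hS.eigenvalues i := by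
  have h1 := h.dotProduct_mulVec_nonneg (hS.eigenvectorBasis i)
  have h2 : star ⇑(hS.eigenvectorBasis i) ⬝ᵥ ⇑(hS.eigenvectorBasis i) = (1 : ℂ) := by
    have h := hS.eigenvectorBasis.orthonormal.1 i
    have h' := inner_self_eq_norm_sq_to_K (𝕜 := ℂ) (hS.eigenvectorBasis i)
    rw [h, EuclideanSpace.inner_eq_star_dotProduct, dotProduct_comm] at h'
    simpa using h'
  rw [sub_mulVec, one_mulVec, hS.mulVec_eigenvectorBasis, dotProduct_sub, dotProduct_smul, h2] at h1
  have h3 := (Complex.le_def.1 h1).1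
  simp at h3
  linarith

/-- A Hermitian matrix bounded below by the identity has determinant between `1` and a power of
its trace. -/
lemma Matrix.IsHermitian.det_bounds_of_one_le {S : Matrix k k ℂ} (hS : S.IsHermitian)
    (h : (S - 1).PosSemidef) :
    ∃ D : ℝ, S.det = D ∧ 1 ≤ D ∧ D ≤ S.trace.re ^ Fintype.card k := by
  have hone := hS.one_le_eigenvalues h
  have htr : S.trace.re = ∑ i, hS.eigenvalues i := by
    rw [hS.trace_eq_sum_eigenvalues]
    simp
  refine ⟨∏ i, hS.eigenvalues i, ?_, ?_, ?_⟩
  · rw [hS.det_eq_prod_eigenvalues]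
    push_cast
    rfl
  · exact Finset.one_le_prod fun i _ => hone i
  · rw [htr, ← Finset.card_univ]
    refine (Finset.prod_le_prod (fun i _ => zero_le_one.trans (hone i)) fun i hi => ?_).trans_eq
      (Finset.prod_const _)
    exact Finset.single_le_sum (f := hS.eigenvalues) (fun j _ => zero_le_one.trans (hone j)) hi

/-- Comparison of the determinant of a matrix bounded below by the identity with that of a
principal block. -/
lemma Matrix.det_toBlocks₁₁_bounds {C : Matrix (m ⊕ k) (m ⊕ k) ℂ} (h : (C - 1).PosSemidef) :
    0 < C.toBlocks₁₁.det.re ∧ C.toBlocks₁₁.det.re ≤ C.det.re ∧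
      C.det.re ≤ C.toBlocks₁₁.det.re * C.toBlocks₂₂.trace.re ^ Fintype.card k := by
  have hC : C.PosDef := h.posDef_of_sub_one
  set A := C.toBlocks₁₁ with hA_def
  set B := C.toBlocks₁₂ with hB_def
  set D := C.toBlocks₂₂ with hD_def
  have hBH : C.toBlocks₂₁ = Bᴴ := by
    ext i j
    exact (hC.1.apply _ _).symm
  have hfrom : C = fromBlocks A B Bᴴ D := by
    rw [← hBH, hA_def, hB_def, hD_def, fromBlocks_toBlocks]
  have hA1 : (A - 1).PosSemidef := by
    have := h.submatrix (Sum.inl : m → m ⊕ k)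
    convert this using 1
    ext i j
    simp [hA_def, toBlocks₁₁, Matrix.one_apply]
  have hA : A.PosDef := hA1.posDef_of_sub_one
  let := hA.isUnit.invertible
  -- This is the Schur complement of `A` after subtracting the identity from the lower right block
  -- only. That matrix is `C - 1` plus a nonnegative diagonal, hence positive semidefinite.
  have hS1 : (D - Bᴴ * A⁻¹ * B - 1).PosSemidef := by
    have h1 : (fromBlocks A B Bᴴ (D - 1)).PosSemidef := by
      have h2 : fromBlocks A B Bᴴ (D - 1) = (C - 1) + diagonal (Sum.elim 1 0) := by
        rw [hfrom, ← fromBlocks_one, ← fromBlocks_diagonal]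
        ext (i | i) (j | j) <;> simp [Matrix.one_apply]
      rw [h2]
      refine h.add (PosSemidef.diagonal ?_)
      rintro (i | i) <;> simp
    rw [hA.fromBlocks₁₁ B (D - 1)] at h1
    rwa [sub_right_comm]
  set S := D - Bᴴ * A⁻¹ * B with hS_def
  obtain ⟨d, hd, hd1, hd2⟩ := hS1.posDef_of_sub_one.1.det_bounds_of_one_le hS1
  obtain ⟨a, ha, ha1, -⟩ := hA.1.det_bounds_of_one_le hA1
  have hdet : C.det = (a * d : ℝ) := by
    rw [hfrom, det_fromBlocks₁₁, invOf_eq_nonsing_inv, ha, ← hS_def, hd]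
    push_cast
    rfl
  -- The subtracted term `Bᴴ * A⁻¹ * B` is positive semidefinite, so the bound involves `D` alone.
  have htr : S.trace.re ≤ D.trace.re := by
    have h1 := (hA.inv.posSemidef.conjTranspose_mul_mul_same B).trace_nonneg
    rw [hS_def, trace_sub, Complex.sub_re]
    have := (Complex.le_def.1 h1).1
    simp only [Complex.zero_re] at this
    linarith
  have hS0 : 0 ≤ S.trace.re :=
    (Complex.le_def.1 hS1.posDef_of_sub_one.posSemidef.trace_nonneg).1
  rw [hdet, ha, Complex.ofReal_re, Complex.ofReal_re]
  refine ⟨by linarith, by nlinarith, ?_⟩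
  exact mul_le_mul_of_nonneg_left (hd2.trans (by gcongr)) (by linarith)

end SchurComplement

/-! ### Riemann sums. -/

section RiemannSum

open Filter Topology

/-- Uniform Riemann sums of a continuous function converge to its mean. -/
lemma tendsto_average_riemannSum {g : ℝ → ℝ} (hg : Continuous g) {T : ℝ} (hT : 0 < T) :
    Tendsto (fun N : ℕ => 1 / (N : ℝ) * ∑ j ∈ Finset.range N, g (T * j / N)) atTop
      (𝓝 (1 / T * ∫ x in (0 : ℝ)..T, g x)) := by
  rw [Metric.tendsto_atTop]
  intro ε hε
  have huc : UniformContinuousOn g (Set.Icc 0 T) :=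
    isCompact_Icc.uniformContinuousOn_of_continuous hg.continuousOn
  -- Each of the `N` cells then errs by at most `ε / 2 * (T / N)`, so the average errs by at most `ε
  -- / 2 < ε`.
  obtain ⟨δ, hδ, hgδ⟩ := Metric.uniformContinuousOn_iff.1 huc (ε / 2) (by positivity)
  obtain ⟨N₀, hN₀⟩ := exists_nat_gt (T / δ)
  refine ⟨N₀ + 1, fun N hN => ?_⟩
  have hNpos : (0 : ℝ) < N := by exact_mod_cast (Nat.succ_pos N₀).trans_le hN
  have hNδ : T / N < δ := by
    have : (N₀ : ℝ) < N := by exact_mod_cast hN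
    rw [div_lt_iff₀ hNpos]
    rw [div_lt_iff₀ hδ] at hN₀
    nlinarith
  have hsplit : ∫ x in (0 : ℝ)..T, g x =
      ∑ j ∈ Finset.range N, ∫ x in (T * j / N)..(T * (j + 1 : ℕ) / N), g x := by
    rw [intervalIntegral.sum_integral_adjacent_intervals (a := fun j : ℕ => T * j / N)
      fun j _ => hg.intervalIntegrable _ _]
    simp [hNpos.ne']
  have hlen : ∀ j : ℕ, T * (j + 1 : ℕ) / N - T * j / N = T / N := fun j => by
    push_cast
    ring
  have hterm : ∀ j ∈ Finset.range N,
      |(∫ x in (T * j / N)..(T * (j + 1 : ℕ) / N), g x) - T / N * g (T * j / N)| ≤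
        ε / 2 * (T / N) := by
    intro j hj
    have hj' : (j : ℝ) + 1 ≤ N := by exact_mod_cast Finset.mem_range.1 hj
    have hle : T * j / N ≤ T * (j + 1 : ℕ) / N := by
      have := hlen j
      have : 0 < T / N := by positivity
      linarith
    have h0 : 0 ≤ T * j / N := by positivity
    have h1 : T * (j + 1 : ℕ) / N ≤ T := by
      rw [div_le_iff₀ hNpos]
      push_cast
      nlinarith
    have hconst : T / N * g (T * j / N) =
        ∫ _x in (T * j / N)..(T * (j + 1 : ℕ) / N), g (T * j / N) := by
      rw [intervalIntegral.integral_const, hlen, smul_eq_mul]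
    rw [hconst, ← intervalIntegral.integral_sub (hg.intervalIntegrable _ _)
      intervalIntegrable_const]
    have := intervalIntegral.norm_integral_le_of_norm_le_const (a := T * j / N)
      (b := T * (j + 1 : ℕ) / N) (f := fun x => g x - g (T * j / N)) (C := ε / 2) fun x hx => by
        rw [Set.uIoc_of_le hle] at hx
        refine (hgδ x ⟨h0.trans hx.1.le, hx.2.trans h1⟩ _ ⟨h0, hle.trans h1⟩ ?_).le
        rw [Real.dist_eq, abs_of_pos (by linarith [hx.1])]
        have := hlen j
        linarith [hx.2]
    rw [hlen, abs_of_pos (by positivity : 0 < T / N)] at this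
    exact this
  have hdiff : 1 / (N : ℝ) * ∑ j ∈ Finset.range N, g (T * j / N) -
      1 / T * ∫ x in (0 : ℝ)..T, g x = -(1 / T * ∑ j ∈ Finset.range N,
        ((∫ x in (T * j / N)..(T * (j + 1 : ℕ) / N), g x) - T / N * g (T * j / N))) := by
    rw [hsplit, Finset.sum_sub_distrib, ← Finset.mul_sum]
    field_simp
    ring
  rw [Real.dist_eq, hdiff, abs_neg, abs_mul, abs_of_pos (by positivity : 0 < 1 / T)]
  calc 1 / T * |∑ j ∈ Finset.range N,
        ((∫ x in (T * j / N)..(T * (j + 1 : ℕ) / N), g x) - T / N * g (T * j / N))|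
      ≤ 1 / T * ∑ j ∈ Finset.range N, ε / 2 * (T / N) := by
        gcongr
        exact (Finset.abs_sum_le_sum_abs _ _).trans (Finset.sum_le_sum hterm)
    _ = ε / 2 := by
        rw [Finset.sum_const, Finset.card_range, nsmul_eq_mul]
        field_simp
    _ < ε := by linarith

end RiemannSum

/-! ### Szegő's theorem for banded block Toeplitz matrices. -/

section BlockToeplitz

open Matrix Filter Topology
open scoped ComplexOrder Kronecker

variable {q : Type*} (K : ℤ → Matrix q q ℂ) (r : ℕ)

/-- The block Toeplitz matrix with blocks `K (k - l)`, the time index being the inner one. -/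
def blockToeplitz (n : ℕ) : Matrix (q × Fin n) (q × Fin n) ℂ :=
  Matrix.of fun x y => K ((x.2 : ℤ) - (y.2 : ℤ)) x.1 y.1

/-- The trigonometric polynomial with matrix coefficients `K d`, `|d| ≤ r`. -/
noncomputable def trigSymbol (ω : ℝ) : Matrix q q ℂ :=
  ∑ d ∈ Finset.Icc (-(r : ℤ)) r, Complex.exp (-(Complex.I * d * ω)) • K d

lemma trigSymbol_apply (ω : ℝ) (i j : q) :
    trigSymbol K r ω i j =
      ∑ d ∈ Finset.Icc (-(r : ℤ)) r, Complex.exp (-(Complex.I * d * ω)) * K d i j := by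
  simp [trigSymbol, Matrix.sum_apply]

lemma continuous_trigSymbol : Continuous (trigSymbol K r) := by
  unfold trigSymbol
  fun_prop

lemma trigSymbol_periodic : Function.Periodic (trigSymbol K r) (2 * Real.pi) := by
  intro ω
  unfold trigSymbol
  refine Finset.sum_congr rfl fun d _ => ?_
  congr 1
  rw [Complex.exp_eq_exp_iff_exists_int]
  refine ⟨-d, ?_⟩
  push_cast
  ring

variable {K}

lemma trigSymbol_isHermitian (hK : ∀ d, K (-d) = (K d)ᴴ) (ω : ℝ) :
    (trigSymbol K r ω).IsHermitian := by
  unfold IsHermitian trigSymbol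
  rw [conjTranspose_sum]
  refine Finset.sum_nbij' (fun d => -d) (fun d => -d) ?_ ?_ ?_ ?_ ?_
  · intro d hd
    rw [Finset.mem_Icc] at hd ⊢
    omega
  · intro d hd
    rw [Finset.mem_Icc] at hd ⊢
    omega
  · simp
  · simp
  · intro d _
    rw [conjTranspose_smul, hK]
    congr 1
    rw [Complex.star_def, ← Complex.exp_conj]
    simp

/-- The number of pairs of indices below `n` with difference `d`. -/
def lagCount (n : ℕ) (d : ℤ) : ℕ :=
  (Finset.univ.filter fun x : Fin n × Fin n => ((x.1 : ℤ) - (x.2 : ℤ)) = d).card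

lemma lagCount_le (n : ℕ) (d : ℤ) : lagCount n d ≤ n := by
  have h : lagCount n d ≤ (Finset.univ : Finset (Fin n)).card := by
    refine Finset.card_le_card_of_injOn Prod.fst (by simp) ?_
    rintro ⟨a, b⟩ h ⟨a', b'⟩ h' rfl
    simp only [Finset.coe_filter, Set.mem_ofPred_eq, Finset.mem_univ, true_and] at h h'
    have : b = b' := Fin.ext (by omega)
    rw [this]
  simpa using h

lemma le_lagCount (n : ℕ) (d : ℤ) : n ≤ lagCount n d + d.natAbs := by
  have h : (Finset.univ : Finset (Fin (n - d.natAbs))).card ≤ lagCount n d := by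
    -- The positive and negative parts of `d` shift the two indices, whose difference is then `d`
    -- for either sign.
    refine Finset.card_le_card_of_injOn (fun k => (⟨k + d.toNat, by omega⟩, ⟨k + (-d).toNat, by omega⟩))
      ?_ ?_
    · intro k _
      simp only [Finset.coe_filter, Set.mem_ofPred_eq, Finset.mem_univ, true_and]
      push_cast
      omega
    · intro k _ l _ hkl
      simp only [Prod.mk.injEq, Fin.mk.injEq] at hkl
      exact Fin.ext (by omega)
  rw [Finset.card_univ, Fintype.card_fin] at h
  omega

lemma tendsto_lagCount_div (d : ℤ) :
    Tendsto (fun n : ℕ => (lagCount n d : ℝ) / n) atTop (𝓝 1) := by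
  have h1 : Tendsto (fun n : ℕ => 1 - (d.natAbs : ℝ) / n) atTop (𝓝 1) := by
    simpa using (tendsto_const_div_atTop_nhds_zero_nat (d.natAbs : ℝ)).const_sub 1
  refine tendsto_of_tendsto_of_tendsto_of_le_of_le' h1 tendsto_const_nhds ?_ ?_
  · filter_upwards [eventually_gt_atTop 0] with n hn
    have hn' : (0 : ℝ) < n := by exact_mod_cast hn
    have : (n : ℝ) ≤ lagCount n d + d.natAbs := by exact_mod_cast le_lagCount n d
    rw [le_div_iff₀ hn', sub_mul, div_mul_cancel₀ _ hn'.ne']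
    linarith
  · filter_upwards with n
    exact div_le_one_of_le₀ (by exact_mod_cast lagCount_le n d) (by positivity)

/-- Pairs are grouped by their difference. The band limit makes the range of lags independent of
`n`, so limits can be taken term by term. -/
lemma sum_sum_lag {φ : ℤ → ℂ} (hφ : ∀ d, (r : ℤ) < |d| → φ d = 0) (n : ℕ) :
    ∑ k : Fin n, ∑ l : Fin n, φ ((k : ℤ) - (l : ℤ)) =
      ∑ d ∈ Finset.Icc (-(r : ℤ)) r, (lagCount n d : ℂ) * φ d := by
  have h : ∀ m : ℤ, φ m = ∑ d ∈ Finset.Icc (-(r : ℤ)) r, if m = d then φ d else 0 := by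
    intro m
    rw [Finset.sum_ite_eq]
    split_ifs with hm
    · rfl
    · refine hφ m ?_
      rw [Finset.mem_Icc, ← abs_le] at hm
      exact not_le.1 hm
  rw [← Fintype.sum_prod_type' (f := fun k l : Fin n => φ ((k : ℤ) - (l : ℤ))),
    Finset.sum_congr rfl fun x _ => h _, Finset.sum_comm]
  refine Finset.sum_congr rfl fun d _ => ?_
  rw [← Finset.sum_filter, Finset.sum_const, nsmul_eq_mul, lagCount]

variable [Fintype q]

/-- The symbol of a family of positive semidefinite banded block Toeplitz matrices is positive
semidefinite. -/
lemma trigSymbol_posSemidef (hK : ∀ d, K (-d) = (K d)ᴴ) (hsupp : ∀ d, (r : ℤ) < |d| → K d = 0)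
    (hpos : ∀ n, (blockToeplitz K n).PosSemidef) (ω : ℝ) : (trigSymbol K r ω).PosSemidef := by
  refine PosSemidef.of_dotProduct_mulVec_nonneg (trigSymbol_isHermitian r hK ω) fun x => ?_
  let φ : ℤ → ℂ := fun d => Complex.exp (-(Complex.I * d * ω)) * (star x ⬝ᵥ (K d *ᵥ x))
  have hφ : ∀ d, (r : ℤ) < |d| → φ d = 0 := fun d hd => by simp [φ, hsupp d hd]
  have hsum : star x ⬝ᵥ (trigSymbol K r ω *ᵥ x) = ∑ d ∈ Finset.Icc (-(r : ℤ)) r, φ d := by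
    unfold trigSymbol
    rw [sum_mulVec, dotProduct_sum]
    refine Finset.sum_congr rfl fun d _ => ?_
    rw [smul_mulVec, dotProduct_smul, smul_eq_mul]
  -- This is the Toeplitz quadratic form at the modulated vector `x ⊗ exp (i k ω)`.
  have hform : ∀ n : ℕ, 0 ≤ ∑ k : Fin n, ∑ l : Fin n, φ ((k : ℤ) - (l : ℤ)) := by
    intro n
    have h := (hpos n).dotProduct_mulVec_nonneg
      fun y => x y.1 * Complex.exp (Complex.I * (y.2 : ℕ) * ω)
    convert h using 1
    simp only [φ, dotProduct, mulVec, Fintype.sum_prod_type_right, Finset.mul_sum, Pi.star_apply,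
      blockToeplitz, of_apply]
    refine Finset.sum_congr rfl fun k _ => ?_
    rw [Finset.sum_comm]
    refine Finset.sum_congr rfl fun i _ => ?_
    refine Finset.sum_congr rfl fun l _ => ?_
    refine Finset.sum_congr rfl fun j _ => ?_
    have he : Complex.exp (-(Complex.I * ((k : ℤ) - (l : ℤ) : ℤ) * ω)) =
        star (Complex.exp (Complex.I * (k : ℕ) * ω)) * Complex.exp (Complex.I * (l : ℕ) * ω) := by
      rw [Complex.star_def, ← Complex.exp_conj, ← Complex.exp_add]
      congr 1
      simp
      ring
    rw [he, star_mul']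
    ring
  -- Divided by `n`, the form is the symbol with Fejér weights, which tend to `1`.
  have hlim : Tendsto (fun n : ℕ => ∑ d ∈ Finset.Icc (-(r : ℤ)) r,
      ((lagCount n d / n : ℝ) : ℂ) * φ d) atTop (𝓝 (∑ d ∈ Finset.Icc (-(r : ℤ)) r, φ d)) := by
    refine tendsto_finsetSum _ fun d _ => ?_
    have h1 := (Complex.continuous_ofReal.tendsto 1).comp (tendsto_lagCount_div d)
    simpa using h1.mul_const (φ d)
  rw [hsum]
  refine ge_of_tendsto' hlim fun n => ?_
  have h := hform n
  rw [sum_sum_lag r hφ] at h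
  have h2 : ∑ d ∈ Finset.Icc (-(r : ℤ)) r, ((lagCount n d / n : ℝ) : ℂ) * φ d =
      ((n : ℝ)⁻¹ : ℝ) * ∑ d ∈ Finset.Icc (-(r : ℤ)) r, (lagCount n d : ℂ) * φ d := by
    rw [Finset.mul_sum]
    refine Finset.sum_congr rfl fun d _ => ?_
    push_cast
    ring
  rw [h2]
  refine mul_nonneg ?_ h
  exact_mod_cast inv_nonneg.2 (Nat.cast_nonneg n)

/-- Orthogonality of the characters of a finite cyclic group. -/
lemma sum_exp_two_pi_div {N : ℕ} (hN : N ≠ 0) (m : ℤ) :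
    ∑ j : Fin N, Complex.exp (Complex.I * m * ((2 * Real.pi * (j : ℕ) / N : ℝ) : ℂ)) =
      if (N : ℤ) ∣ m then (N : ℂ) else 0 := by
  have hN' : (N : ℂ) ≠ 0 := by exact_mod_cast hN
  set z := Complex.exp (2 * Real.pi * Complex.I * (m / N)) with hz
  have hpow : ∀ j : ℕ, Complex.exp (Complex.I * m * ((2 * Real.pi * j / N : ℝ) : ℂ)) = z ^ j := by
    intro j
    rw [hz, ← Complex.exp_nat_mul]
    congr 1
    push_cast
    ring
  simp only [hpow]
  rw [Fin.sum_univ_eq_sum_range (fun j => z ^ j) N]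
  have hzN : z ^ N = 1 := by
    rw [hz, ← Complex.exp_nat_mul, Complex.exp_eq_one_iff]
    exact ⟨m, by field_simp⟩
  have hz1 : z = 1 ↔ (N : ℤ) ∣ m := by
    rw [hz, Complex.exp_eq_one_iff]
    have hpi : (2 * Real.pi * Complex.I : ℂ) ≠ 0 := Complex.two_pi_I_ne_zero
    constructor
    · rintro ⟨c, hc⟩
      refine ⟨c, ?_⟩
      rw [mul_comm (c : ℂ)] at hc
      have := mul_left_cancel₀ hpi hc
      rw [div_eq_iff hN'] at this
      rw [mul_comm]
      exact_mod_cast this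
    · rintro ⟨c, rfl⟩
      refine ⟨c, ?_⟩
      push_cast
      field_simp
  split_ifs with h
  · simp [hz1.2 h]
  · have hne : z ≠ 1 := fun h' => h (hz1.1 h')
    rw [geom_sum_eq hne, hzN, sub_self, zero_div]

/-- The unitary discrete Fourier transform matrix. -/
noncomputable def dftMatrix (N : ℕ) : Matrix (Fin N) (Fin N) ℂ :=
  Matrix.of fun k j => ((Real.sqrt N)⁻¹ : ℝ) *
    Complex.exp (Complex.I * (k : ℕ) * ((2 * Real.pi * (j : ℕ) / N : ℝ) : ℂ))

lemma dftMatrix_mul_star (N : ℕ) (k l j : Fin N) :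
    dftMatrix N k j * star (dftMatrix N l j) = (N : ℂ)⁻¹ *
      Complex.exp (Complex.I * ((k : ℤ) - (l : ℤ) : ℤ) * ((2 * Real.pi * (j : ℕ) / N : ℝ) : ℂ)) := by
  have hs : (((Real.sqrt N)⁻¹ : ℝ) : ℂ) * ((Real.sqrt N)⁻¹ : ℝ) = (N : ℂ)⁻¹ := by
    rw [← Complex.ofReal_mul, ← mul_inv, Real.mul_self_sqrt (Nat.cast_nonneg N)]
    simp
  rw [← hs, dftMatrix, of_apply, of_apply, star_mul', Complex.star_def,
    Complex.conj_ofReal, ← Complex.exp_conj]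
  have he : Complex.exp (Complex.I * ((k : ℤ) - (l : ℤ) : ℤ) *
      ((2 * Real.pi * (j : ℕ) / N : ℝ) : ℂ)) =
      Complex.exp (Complex.I * (k : ℕ) * ((2 * Real.pi * (j : ℕ) / N : ℝ) : ℂ)) *
      Complex.exp ((starRingEnd ℂ) (Complex.I * (l : ℕ) *
        ((2 * Real.pi * (j : ℕ) / N : ℝ) : ℂ))) := by
    rw [← Complex.exp_add]
    congr 1
    simp only [map_mul, Complex.conj_I, Complex.conj_ofReal, map_natCast]
    push_cast
    ring
  rw [he]
  ring

lemma dftMatrix_mul_conjTranspose (N : ℕ) : dftMatrix N * (dftMatrix N)ᴴ = 1 := by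
  ext k l
  have hN : N ≠ 0 := fun h => by subst h; exact k.elim0
  have hN' : (N : ℂ) ≠ 0 := by exact_mod_cast hN
  simp only [Matrix.mul_apply, conjTranspose_apply, dftMatrix_mul_star]
  rw [← Finset.mul_sum, sum_exp_two_pi_div hN, Matrix.one_apply]
  have : ((N : ℤ) ∣ ((k : ℤ) - (l : ℤ))) ↔ k = l := by
    constructor
    · intro h
      have := Int.eq_zero_of_abs_lt_dvd h (by rw [abs_lt]; omega)
      exact Fin.ext (by omega)
    · rintro rfl
      simp
  simp only [this]
  split_ifs <;> simp [hN']

variable [DecidableEq q]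

variable (K) in
/-- The block circulant matrix whose Fourier blocks are the samples of the symbol. -/
noncomputable def blockCirculant (N : ℕ) : Matrix (q × Fin N) (q × Fin N) ℂ :=
  ((1 : Matrix q q ℂ) ⊗ₖ dftMatrix N) *
    blockDiagonal (fun j : Fin N => trigSymbol K r (2 * Real.pi * (j : ℕ) / N)) *
    ((1 : Matrix q q ℂ) ⊗ₖ dftMatrix N)ᴴ

lemma one_kronecker_dftMatrix_mul (N : ℕ) :
    ((1 : Matrix q q ℂ) ⊗ₖ dftMatrix N) * ((1 : Matrix q q ℂ) ⊗ₖ dftMatrix N)ᴴ = 1 := by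
  rw [conjTranspose_kronecker, ← mul_kronecker_mul, dftMatrix_mul_conjTranspose,
    conjTranspose_one, Matrix.one_mul, one_kronecker_one]

/-- Inverting the Fourier transform of the samples gives the aliased sum of `K d` over `d ≡ k - l`
modulo `N` with `|d| ≤ r`. Since `|k - l - d| ≤ |k - l| + r < N`, only `d = k - l` can survive. -/
lemma blockCirculant_apply {N : ℕ} {i i' : q} {k l : Fin N}
    (hkl : |(k : ℤ) - (l : ℤ)| + r < N) (hsupp : ∀ d, (r : ℤ) < |d| → K d = 0) :
    blockCirculant K r N (i, k) (i', l) = K ((k : ℤ) - (l : ℤ)) i i' := by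
  have hN : N ≠ 0 := fun h => by subst h; exact k.elim0
  have hN' : (N : ℂ) ≠ 0 := by exact_mod_cast hN
  have h1 : blockCirculant K r N (i, k) (i', l) = ∑ j : Fin N, dftMatrix N k j *
      star (dftMatrix N l j) * trigSymbol K r (2 * Real.pi * (j : ℕ) / N) i i' := by
    have hleft : ∀ a j, (((1 : Matrix q q ℂ) ⊗ₖ dftMatrix N) * blockDiagonal (fun j : Fin N =>
        trigSymbol K r (2 * Real.pi * (j : ℕ) / N))) (i, k) (a, j) =
        dftMatrix N k j * trigSymbol K r (2 * Real.pi * (j : ℕ) / N) i a := by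
      intro a j
      rw [Matrix.mul_apply, Fintype.sum_prod_type, Finset.sum_eq_single i, Finset.sum_eq_single j]
      · simp [blockDiagonal_apply]
      · intro l _ hl
        simp [blockDiagonal_apply, hl]
      · simp
      · intro a _ ha
        simp [Matrix.one_apply_ne ha.symm]
      · simp
    rw [blockCirculant, Matrix.mul_apply, Fintype.sum_prod_type, Finset.sum_eq_single i']
    · refine Finset.sum_congr rfl fun j _ => ?_
      rw [hleft, conjTranspose_apply, kroneckerMap_apply, Matrix.one_apply_eq, one_mul]
      ring
    · intro a _ ha
      simp [Matrix.one_apply_ne ha.symm]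
    · simp
  rw [h1]
  simp only [dftMatrix_mul_star, trigSymbol_apply, Finset.mul_sum]
  rw [Finset.sum_comm]
  have h2 : ∀ d ∈ Finset.Icc (-(r : ℤ)) r, ∑ j : Fin N, (N : ℂ)⁻¹ *
      Complex.exp (Complex.I * ((k : ℤ) - (l : ℤ) : ℤ) * ((2 * Real.pi * (j : ℕ) / N : ℝ) : ℂ)) *
      (Complex.exp (-(Complex.I * d * ((2 * Real.pi * (j : ℕ) / N : ℝ) : ℂ))) * K d i i') =
      if (k : ℤ) - (l : ℤ) = d then K d i i' else 0 := by
    intro d hd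
    have h3 : ∀ j : Fin N, (N : ℂ)⁻¹ *
        Complex.exp (Complex.I * ((k : ℤ) - (l : ℤ) : ℤ) *
          ((2 * Real.pi * (j : ℕ) / N : ℝ) : ℂ)) *
        (Complex.exp (-(Complex.I * d * ((2 * Real.pi * (j : ℕ) / N : ℝ) : ℂ))) * K d i i') =
        ((N : ℂ)⁻¹ * K d i i') * Complex.exp (Complex.I * ((k : ℤ) - (l : ℤ) - d : ℤ) *
          ((2 * Real.pi * (j : ℕ) / N : ℝ) : ℂ)) := by
      intro j
      rw [show Complex.I * ((k : ℤ) - (l : ℤ) - d : ℤ) * ((2 * Real.pi * (j : ℕ) / N : ℝ) : ℂ) =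
        Complex.I * ((k : ℤ) - (l : ℤ) : ℤ) * ((2 * Real.pi * (j : ℕ) / N : ℝ) : ℂ) +
        -(Complex.I * d * ((2 * Real.pi * (j : ℕ) / N : ℝ) : ℂ)) by push_cast; ring,
        Complex.exp_add]
      ring
    rw [Finset.sum_congr rfl fun j _ => h3 j, ← Finset.mul_sum, sum_exp_two_pi_div hN]
    have h4 : (N : ℤ) ∣ (k : ℤ) - (l : ℤ) - d ↔ (k : ℤ) - (l : ℤ) = d := by
      constructor
      · intro h
        rw [Finset.mem_Icc, ← abs_le] at hd
        have := Int.eq_zero_of_abs_lt_dvd h ((abs_sub _ _).trans_lt (by omega))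
        omega
      · intro h
        simp [h]
    simp only [h4]
    split_ifs
    · field_simp
    · simp
  rw [Finset.sum_congr rfl h2, Finset.sum_ite_eq]
  split_ifs with hm
  · rfl
  · rw [Finset.mem_Icc, ← abs_le] at hm
    rw [hsupp _ (not_le.1 hm), Matrix.zero_apply]

lemma det_one_add_smul_blockCirculant (γ : ℂ) (N : ℕ) :
    (1 + γ • blockCirculant K r N).det =
      ∏ j : Fin N, (1 + γ • trigSymbol K r (2 * Real.pi * (j : ℕ) / N)).det := by
  have hW := one_kronecker_dftMatrix_mul (q := q) N
  set W := (1 : Matrix q q ℂ) ⊗ₖ dftMatrix N with hW_def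
  have hW' : Wᴴ * W = 1 := mul_eq_one_comm.1 hW
  have h1 : 1 + γ • blockCirculant K r N = W * blockDiagonal (fun j : Fin N =>
      1 + γ • trigSymbol K r (2 * Real.pi * (j : ℕ) / N)) * Wᴴ := by
    have h2 : blockDiagonal (fun j : Fin N =>
        1 + γ • trigSymbol K r (2 * Real.pi * (j : ℕ) / N)) = 1 + γ • blockDiagonal
        (fun j : Fin N => trigSymbol K r (2 * Real.pi * (j : ℕ) / N)) := by
      rw [← blockDiagonal_one, ← blockDiagonal_smul, ← blockDiagonal_add]
      rfl
    rw [h2, Matrix.mul_add, Matrix.add_mul, Matrix.mul_one, hW, Matrix.mul_smul, Matrix.smul_mul]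
    rfl
  rw [h1, Matrix.mul_assoc, det_mul_comm, Matrix.mul_assoc, hW', Matrix.mul_one,
    det_blockDiagonal]

lemma blockCirculant_posSemidef (hpos : ∀ ω, (trigSymbol K r ω).PosSemidef) (N : ℕ) :
    (blockCirculant K r N).PosSemidef := by
  refine PosSemidef.mul_mul_conjTranspose_same ?_ _
  refine PosSemidef.of_dotProduct_mulVec_nonneg ?_ fun x => ?_
  · rw [IsHermitian, blockDiagonal_conjTranspose]
    congr 1
    funext j
    exact (hpos _).1
  · have h := fun j : Fin N => (hpos (2 * Real.pi * (j : ℕ) / N)).dotProduct_mulVec_nonneg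
      fun i => x (i, j)
    convert Finset.sum_nonneg fun j (_ : j ∈ Finset.univ) => h j using 1
    simp only [dotProduct, mulVec, Fintype.sum_prod_type_right, blockDiagonal_apply,
      Pi.star_apply]
    refine Finset.sum_congr rfl fun j _ => Finset.sum_congr rfl fun i _ => ?_
    rw [Finset.sum_eq_single j]
    · simp
    · intro l _ hl
      simp [hl.symm]
    · simp

lemma one_le_det_one_add_smul {H : Matrix q q ℂ} (hH : H.PosSemidef) {γ : ℝ} (hγ : 0 ≤ γ) :
    1 ≤ (1 + (γ : ℂ) • H).det.re := by
  rw [hH.1.det_one_add_smul, Complex.ofReal_re]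
  exact Finset.one_le_prod fun i _ =>
    le_add_of_nonneg_right (mul_nonneg hγ (hH.eigenvalues_nonneg i))

/-- The block circulant matrix of size `n + r` extends the block Toeplitz matrix of size `n`, so
that their log-determinants differ by a bounded amount. -/
lemma logDet_blockToeplitz_bounds (hsupp : ∀ d, (r : ℤ) < |d| → K d = 0)
    (hpos : ∀ ω, (trigSymbol K r ω).PosSemidef) {γ : ℝ} (hγ : 0 ≤ γ) :
    ∃ M : ℝ, ∀ n : ℕ, n ≠ 0 →
      Real.log (1 + (γ : ℂ) • blockToeplitz K n).det.re ≤
        Real.log (1 + (γ : ℂ) • blockCirculant K r (n + r)).det.re ∧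
      Real.log (1 + (γ : ℂ) • blockCirculant K r (n + r)).det.re ≤
        Real.log (1 + (γ : ℂ) • blockToeplitz K n).det.re + M := by
  -- The trace of the complementary `r`-block corner, independent of `n`.
  let t : ℝ := (∑ x : q × Fin r, (1 + (γ : ℂ) * K 0 x.1 x.1)).re
  refine ⟨Real.log (t ^ Fintype.card (q × Fin r)), fun n hn => ?_⟩
  let e : (q × Fin n) ⊕ (q × Fin r) ≃ q × Fin (n + r) :=
    (Equiv.prodSumDistrib q (Fin n) (Fin r)).symm.trans (Equiv.prodCongr (Equiv.refl q) finSumFinEquiv)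
  let C := (1 + (γ : ℂ) • blockCirculant K r (n + r)).submatrix e e
  have hdetC : C.det = (1 + (γ : ℂ) • blockCirculant K r (n + r)).det := det_submatrix_equiv_self e _
  have hC : (C - 1).PosSemidef := by
    have h : C - 1 = ((γ : ℂ) • blockCirculant K r (n + r)).submatrix e e := by
      ext x y
      simp [C, Matrix.one_apply]
    rw [h]
    refine PosSemidef.submatrix ?_ e
    exact (blockCirculant_posSemidef r hpos _).smul (by exact_mod_cast hγ)
  have hA : C.toBlocks₁₁ = 1 + (γ : ℂ) • blockToeplitz K n := by
    ext ⟨i, k⟩ ⟨j, l⟩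
    have hk := k.2
    have hl := l.2
    have h : blockCirculant K r (n + r) (i, Fin.castAdd r k) (j, Fin.castAdd r l) =
        K ((k : ℤ) - (l : ℤ)) i j :=
      blockCirculant_apply r (k := Fin.castAdd r k) (l := Fin.castAdd r l)
        (by
          simp only [Fin.val_castAdd]
          have : |(k : ℤ) - (l : ℤ)| < n := by rw [abs_lt]; omega
          push_cast
          linarith) hsupp
    simp [C, e, toBlocks₁₁, blockToeplitz, h, Matrix.one_apply]
  have hD : C.toBlocks₂₂.trace.re = t := by
    congr 1
    refine Finset.sum_congr rfl fun x _ => ?_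
    have h : blockCirculant K r (n + r) (x.1, Fin.natAdd n x.2) (x.1, Fin.natAdd n x.2) =
        K 0 x.1 x.1 := by
      -- On the diagonal the no-aliasing condition reads `r < n + r`, which is where `n ≠ 0` enters.
      rw [blockCirculant_apply r (by simp; omega) hsupp, sub_self]
    simp [C, e, toBlocks₂₂, h]
  obtain ⟨h0, h1, h2⟩ := det_toBlocks₁₁_bounds hC
  rw [hA, hdetC, hD] at *
  have h3 : t ^ Fintype.card (q × Fin r) ≠ 0 := fun h => by
    rw [h, mul_zero] at h2
    linarith
  refine ⟨Real.log_le_log h0 h1, ?_⟩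
  rw [← Real.log_mul h0.ne' h3]
  exact Real.log_le_log (h0.trans_le h1) h2

/-- **Szegő's theorem** for banded positive semidefinite block Toeplitz matrices. -/
theorem tendsto_logDet_blockToeplitz (hK : ∀ d, K (-d) = (K d)ᴴ)
    (hsupp : ∀ d, (r : ℤ) < |d| → K d = 0) (hpos : ∀ n, (blockToeplitz K n).PosSemidef)
    {γ : ℝ} (hγ : 0 ≤ γ) :
    Continuous (fun ω => Real.log (1 + (γ : ℂ) • trigSymbol K r ω).det.re) ∧
    Tendsto (fun n : ℕ => 1 / (n : ℝ) * Real.log (1 + (γ : ℂ) • blockToeplitz K n).det.re) atTop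
      (𝓝 (1 / (2 * Real.pi) * ∫ ω in (-Real.pi)..Real.pi,
        Real.log (1 + (γ : ℂ) • trigSymbol K r ω).det.re)) := by
  have hsym := trigSymbol_posSemidef r hK hsupp hpos
  let g : ℝ → ℝ := fun ω => Real.log (1 + (γ : ℂ) • trigSymbol K r ω).det.re
  have hone : ∀ ω, 1 ≤ (1 + (γ : ℂ) • trigSymbol K r ω).det.re := fun ω =>
    one_le_det_one_add_smul (hsym ω) hγ
  have hcont : Continuous g := by
    refine Continuous.log ?_ fun ω => (one_pos.trans_le (hone ω)).ne'
    have h : Continuous fun ω => 1 + (γ : ℂ) • trigSymbol K r ω := by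
      have := continuous_trigSymbol K r
      fun_prop
    exact Complex.continuous_re.comp h.matrix_det
  have hper : Function.Periodic g (2 * Real.pi) := fun ω => by
    simp only [g, trigSymbol_periodic K r ω]
  refine ⟨hcont, ?_⟩
  -- The Fourier samples lie in `[0, 2π)`; periodicity moves the interval.
  have hshift : ∫ ω in (-Real.pi)..Real.pi, g ω = ∫ ω in (0 : ℝ)..(2 * Real.pi), g ω := by
    have h := hper.intervalIntegral_add_eq (-Real.pi) 0
    rwa [zero_add, show -Real.pi + 2 * Real.pi = Real.pi by ring] at h
  have hcirc : ∀ N : ℕ, Real.log (1 + (γ : ℂ) • blockCirculant K r N).det.re =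
      ∑ j ∈ Finset.range N, g (2 * Real.pi * j / N) := by
    intro N
    have hreal : ∀ ω, (1 + (γ : ℂ) • trigSymbol K r ω).det =
        ((1 + (γ : ℂ) • trigSymbol K r ω).det.re : ℂ) := fun ω => by
      rw [(hsym ω).1.det_one_add_smul, Complex.ofReal_re]
    rw [det_one_add_smul_blockCirculant, Finset.prod_congr rfl fun j _ => hreal _,
      ← Complex.ofReal_prod, Complex.ofReal_re,
      Real.log_prod fun j _ => (one_pos.trans_le (hone _)).ne',
      Finset.sum_range fun j => g (2 * Real.pi * j / N)]
  obtain ⟨M, hM⟩ := logDet_blockToeplitz_bounds r hsupp hsym hγ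
  have hR := tendsto_average_riemannSum hcont Real.two_pi_pos
  rw [← hshift] at hR
  have hR' := hR.comp (tendsto_add_atTop_nat r)
  -- Converts normalization by the circulant size `n + r` into normalization by `n`.
  have hratio : Tendsto (fun n : ℕ => ((n + r : ℕ) : ℝ) / n) atTop (𝓝 1) := by
    have h := (tendsto_const_div_atTop_nhds_zero_nat (r : ℝ)).const_add 1
    rw [add_zero] at h
    refine h.congr' ?_
    filter_upwards [eventually_gt_atTop 0] with n hn
    have : (n : ℝ) ≠ 0 := by exact_mod_cast hn.ne'
    push_cast
    field_simp
  have hup : Tendsto (fun n : ℕ => 1 / (n : ℝ) *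
      Real.log (1 + (γ : ℂ) • blockCirculant K r (n + r)).det.re) atTop
      (𝓝 (1 / (2 * Real.pi) * ∫ ω in (-Real.pi)..Real.pi, g ω)) := by
    have h := hratio.mul hR'
    rw [one_mul] at h
    refine h.congr' ?_
    filter_upwards [eventually_gt_atTop 0] with n hn
    have h1 : (n : ℝ) ≠ 0 := by exact_mod_cast hn.ne'
    have h2 : ((n + r : ℕ) : ℝ) ≠ 0 := by exact_mod_cast (by omega : n + r ≠ 0)
    rw [hcirc, Function.comp_apply]
    field_simp
  have hlow := hup.sub (tendsto_const_div_atTop_nhds_zero_nat M)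
  rw [sub_zero] at hlow
  refine tendsto_of_tendsto_of_tendsto_of_le_of_le' hlow hup ?_ ?_
  · filter_upwards [eventually_gt_atTop 0] with n hn
    have h := (hM n hn.ne').2
    have hn' : (0 : ℝ) < n := by exact_mod_cast hn
    rw [div_eq_mul_one_div M, mul_comm M, ← mul_sub]
    exact mul_le_mul_of_nonneg_left (by linarith) (by positivity)
  · filter_upwards [eventually_gt_atTop 0] with n hn
    exact mul_le_mul_of_nonneg_left (hM n hn.ne').1 (by positivity)

end BlockToeplitz

/-! ### The relay channel as a block Toeplitz matrix. -/

namespace RelayLink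

open Matrix Filter Topology
open scoped ComplexOrder

variable (L : RelayLink)

/-- The matrix Fourier coefficients of the symbol `T_E`. -/
noncomputable def taps (d : ℤ) : Matrix (Fin 2) (Fin 2) ℂ :=
  !![((‖L.α 0‖ ^ 2 : ℝ) : ℂ) * L.t₁₁ d, L.α 0 * starRingEnd ℂ (L.α 1) * L.t₁₂ d;
     starRingEnd ℂ (L.α 0) * L.α 1 * L.t₂₁ d, ((‖L.α 1‖ ^ 2 : ℝ) : ℂ) * L.t₂₂ d]

lemma t₁₁_neg (d : ℤ) : L.t₁₁ (-d) = starRingEnd ℂ (L.t₁₁ d) := by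
  unfold t₁₁
  split_ifs <;> first | (exfalso; omega) | simp

lemma t₂₂_neg (d : ℤ) : L.t₂₂ (-d) = starRingEnd ℂ (L.t₂₂ d) := by
  unfold t₂₂
  split_ifs <;> first | (exfalso; omega) | simp

lemma taps_neg (d : ℤ) : L.taps (-d) = (L.taps d)ᴴ := by
  ext i j
  fin_cases i <;> fin_cases j <;> simp [taps, t₁₁_neg, t₂₂_neg, t₂₁]

lemma t₁₁_eq_zero {d : ℤ} (hd : 2 < |d|) : L.t₁₁ d = 0 := by
  rw [lt_abs] at hd
  unfold t₁₁
  split_ifs <;> first | (exfalso; omega) | rfl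

lemma t₂₂_eq_zero {d : ℤ} (hd : 2 < |d|) : L.t₂₂ d = 0 := by
  rw [lt_abs] at hd
  unfold t₂₂
  split_ifs <;> first | (exfalso; omega) | rfl

lemma t₁₂_eq_zero {d : ℤ} (hd : 2 < |d|) : L.t₁₂ d = 0 := by
  rw [lt_abs] at hd
  unfold t₁₂
  split_ifs <;> first | (exfalso; omega) | rfl

lemma t₂₁_eq_zero {d : ℤ} (hd : 2 < |d|) : L.t₂₁ d = 0 := by
  rw [t₂₁, t₁₂_eq_zero L (by rwa [abs_neg]), map_zero]

lemma taps_eq_zero (d : ℤ) (hd : ((2 : ℕ) : ℤ) < |d|) : L.taps d = 0 := by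
  have hd' : 2 < |d| := by exact_mod_cast hd
  ext i j
  fin_cases i <;> fin_cases j <;>
    simp [taps, t₁₁_eq_zero L hd', t₁₂_eq_zero L hd', t₂₁_eq_zero L hd', t₂₂_eq_zero L hd']

/-- The gains enter the channel taps and the symbol with opposite conjugations. As `H_E(-d) =
H_E(d)†`, this amounts to a transpose together with a reversal of the lag. -/
lemma HE_neg_apply (d : ℤ) (i j : Fin 2) : L.HE (-d) j i = L.taps d i j := by
  by_cases hd : 2 < |d|
  · rw [taps_eq_zero L d (by exact_mod_cast hd)]
    rw [lt_abs] at hd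
    unfold HE
    split_ifs <;> first | (exfalso; omega) | rfl
  · have h : d = 0 ∨ d = 1 ∨ d = -1 ∨ d = 2 ∨ d = -2 := by
      rw [not_lt, abs_le] at hd
      omega
    rcases h with rfl | rfl | rfl | rfl | rfl <;> fin_cases i <;> fin_cases j <;>
      simp [HE, HE0, HE1, HE2, taps, t₁₁, t₂₂, t₂₁, t₁₂] <;> ring

/-- Transposition and reindexing preserve determinants and positivity, so both transfer from the
channel matrix to the Toeplitz form with symbol `T_E`. -/
lemma blockToeplitz_taps (n : ℕ) :
    blockToeplitz L.taps n = ((L.channelMatrix n).submatrix Prod.swap Prod.swap)ᵀ := by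
  ext ⟨i, k⟩ ⟨j, l⟩
  simp only [blockToeplitz, of_apply, transpose_apply, submatrix_apply, Prod.swap_prod_mk,
    channelMatrix, ← HE_neg_apply, neg_sub]

lemma det_one_add_smul_channelMatrix (γ : ℂ) (n : ℕ) :
    (1 + γ • L.channelMatrix n).det = (1 + γ • blockToeplitz L.taps n).det := by
  have h : 1 + γ • blockToeplitz L.taps n =
      ((1 + γ • L.channelMatrix n).submatrix (Equiv.prodComm (Fin 2) (Fin n))
        (Equiv.prodComm (Fin 2) (Fin n)))ᵀ := by
    rw [blockToeplitz_taps]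
    ext ⟨i, k⟩ ⟨j, l⟩
    simp [Matrix.one_apply, and_comm, eq_comm]
  rw [h, det_transpose, det_submatrix_equiv_self]

lemma det_one_add_smul_blockMatrix (γ : ℂ) (n : ℕ) :
    (1 + γ • L.blockMatrix n).det = (1 + γ • blockToeplitz L.taps n).det := by
  let e : Fin n ⊕ Fin n ≃ Fin 2 × Fin n := (Equiv.boolProdEquivSum (Fin n)).symm.trans
    (Equiv.prodCongr finTwoEquiv.symm (Equiv.refl _))
  have hl : ∀ k : Fin n, e (.inl k) = (0, k) := fun k => rfl
  have hr : ∀ k : Fin n, e (.inr k) = (1, k) := fun k => rfl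
  have h : 1 + γ • L.blockMatrix n = (1 + γ • blockToeplitz L.taps n).submatrix e e := by
    ext (k | k) (l | l) <;>
      simp [hl, hr, blockMatrix, blockToeplitz, taps, toeplitz, Matrix.one_apply]
  rw [h, det_submatrix_equiv_self]

lemma dtft_eq_sum {t : ℤ → ℂ} (ht : ∀ d, 2 < |d| → t d = 0) (ω : ℝ) :
    dtft t ω = ∑ d ∈ Finset.Icc (-2 : ℤ) 2, t d * Complex.exp (-(Complex.I * d * ω)) := by
  refine tsum_eq_sum fun d hd => ?_
  rw [Finset.mem_Icc, ← abs_le] at hd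
  rw [ht d (not_le.1 hd), zero_mul]

lemma symbol_eq_trigSymbol (ω : ℝ) : L.symbol ω = trigSymbol L.taps 2 ω := by
  ext i j
  rw [trigSymbol_apply]
  fin_cases i <;> fin_cases j <;>
    simp only [symbol, taps, Fin.zero_eta, Fin.mk_one, of_apply, cons_val', cons_val_zero,
      cons_val_one, cons_val_fin_one, Nat.cast_ofNat]
  · rw [dtft_eq_sum fun d => t₁₁_eq_zero L, Finset.mul_sum]
    exact Finset.sum_congr rfl fun d _ => by ring
  · rw [dtft_eq_sum fun d => t₁₂_eq_zero L, Finset.mul_sum]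
    exact Finset.sum_congr rfl fun d _ => by ring
  · rw [dtft_eq_sum fun d => t₂₁_eq_zero L, Finset.mul_sum]
    exact Finset.sum_congr rfl fun d _ => by ring
  · rw [dtft_eq_sum fun d => t₂₂_eq_zero L, Finset.mul_sum]
    exact Finset.sum_congr rfl fun d _ => by ring

lemma Icc_neg_two_two : Finset.Icc (-2 : ℤ) 2 = {-2, -1, 0, 1, 2} := by decide

lemma dtft_t₁₁ (ω : ℝ) : dtft L.t₁₁ ω =
    1 + L.a₁ * Complex.exp (-(Complex.I * ω)) + L.a₁ * Complex.exp (Complex.I * ω) := by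
  rw [dtft_eq_sum fun d => t₁₁_eq_zero L, Icc_neg_two_two]
  simp [t₁₁]
  ring

lemma dtft_t₂₂ (ω : ℝ) : dtft L.t₂₂ ω =
    1 + L.d₁ * Complex.exp (-(Complex.I * ω)) + L.d₁ * Complex.exp (Complex.I * ω) := by
  rw [dtft_eq_sum fun d => t₂₂_eq_zero L, Icc_neg_two_two]
  simp [t₂₂]
  ring

lemma dtft_t₁₂ (ω : ℝ) : dtft L.t₁₂ ω =
    L.c₁ * Complex.exp (-(Complex.I * ω)) + L.c₂ * Complex.exp (-(Complex.I * 2 * ω)) +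
      L.c₀ + L.f₁ * Complex.exp (Complex.I * ω) := by
  rw [dtft_eq_sum fun d => t₁₂_eq_zero L, Icc_neg_two_two]
  simp [t₁₂]
  ring

/-- Positivity keeps every factor `1 + γ ν` nonzero, so the logarithm of the product splits. -/
lemma rateDensity_eq_log_det {ω : ℝ} (hpos : (L.symbol ω).PosSemidef) :
    L.rateDensity ω = Real.log
      (1 + ((2 / (numTransmitters : ℝ) * L.snr : ℝ) : ℂ) • L.symbol ω).det.re := by
  have hγ : 0 ≤ 2 / (numTransmitters : ℝ) * L.snr :=
    mul_nonneg (by positivity) (div_nonneg L.Ps_pos.le L.N0_pos.le)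
  have hne : ∀ i, 1 + 2 / (numTransmitters : ℝ) * L.snr *
      (L.symbol_isHermitian ω).eigenvalues i ≠ 0 := fun i =>
    (add_pos_of_pos_of_nonneg one_pos (mul_nonneg hγ (hpos.eigenvalues_nonneg i))).ne'
  rw [(L.symbol_isHermitian ω).det_one_add_smul, Complex.ofReal_re,
    Real.log_prod fun i _ => hne i]
  -- `eigenvalues` is the sorted list `eigenvalues₀` reindexed by an arbitrary equivalence; `σ`
  -- undoes it, and the sum does not see the order.
  let σ : Fin 2 ≃ Fin 2 := (finCongr (Fintype.card_fin 2).symm).trans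
    (Fintype.equivOfCardEq (Fintype.card_fin _))
  rw [rateDensity, ← σ.sum_comp fun i => Real.log (1 + 2 / (numTransmitters : ℝ) * L.snr *
    (L.symbol_isHermitian ω).eigenvalues i)]
  refine Finset.sum_congr rfl fun j _ => ?_
  simp [symbolEigenvalue, IsHermitian.eigenvalues, σ]

/-- The channel matrix is a multiple of a noise covariance, hence positive semidefinite. -/
lemma channelMatrix_posSemidef {Ω : Type*} [MeasurableSpace Ω] {P : Measure Ω} {n : ℕ}
    {z : Ω → Fin n × Fin 2 → ℂ}
    (hz : IsProperComplexGaussian P z ((L.N0 : ℂ) • L.channelMatrix n)) :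
    (L.channelMatrix n).PosSemidef := by
  have h := hz.posSemidef.smul
    (show (0 : ℂ) ≤ ((L.N0⁻¹ : ℝ) : ℂ) by exact_mod_cast inv_nonneg.2 L.N0_pos.le)
  rwa [smul_smul, ← Complex.ofReal_mul, inv_mul_cancel₀ L.N0_pos.ne', Complex.ofReal_one,
    one_smul] at h

lemma blockToeplitz_taps_posSemidef {n : ℕ} (h : (L.channelMatrix n).PosSemidef) :
    (blockToeplitz L.taps n).PosSemidef := by
  rw [L.blockToeplitz_taps]
  exact (h.submatrix _).transpose

end RelayLink

theorem theorem6 (L : RelayLink) {Ω : Type*} [MeasurableSpace Ω] (P : Measure Ω)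
    (b z : (n : ℕ) → Ω → Fin n × Fin 2 → ℂ)
    (hb : ∀ n, IsProperComplexGaussian P (b n) ((L.symbolPower : ℂ) • 1))
    (hz : ∀ n, IsProperComplexGaussian P (z n) ((L.N0 : ℂ) • L.channelMatrix n))
    (hbz : ∀ n, IndepFun (b n) (z n) P) :
    -- the normalized mutual information is the normalized log-determinant
    (∀ n, mutualInfo P (L.output n (b n) (z n)) (b n) ≠ ⊤ ∧
      (mutualInfo P (L.output n (b n) (z n)) (b n)).toReal = L.logDet n) ∧
    -- its limit
    IntervalIntegrable L.rateDensity volume (-Real.pi) Real.pi ∧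
    Filter.Tendsto
      (fun n : ℕ => 1 / (n : ℝ) * (mutualInfo P (L.output n (b n) (z n)) (b n)).toReal)
      Filter.atTop
      (nhds (1 / (2 * Real.pi) * ∫ ω in (-Real.pi)..Real.pi, L.rateDensity ω)) ∧
    Filter.Tendsto (fun n : ℕ => 1 / (n : ℝ) * L.logDet n) Filter.atTop
      (nhds (1 / (2 * Real.pi) * ∫ ω in (-Real.pi)..Real.pi, L.rateDensity ω)) ∧
    -- the entries of the symbol
    (∀ ω : ℝ,
      RelayLink.dtft L.t₁₁ ω =
        1 + L.a₁ * Complex.exp (-(Complex.I * ω)) + L.a₁ * Complex.exp (Complex.I * ω) ∧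
      RelayLink.dtft L.t₁₂ ω =
        L.c₁ * Complex.exp (-(Complex.I * ω)) + L.c₂ * Complex.exp (-(Complex.I * 2 * ω)) +
          L.c₀ + L.f₁ * Complex.exp (Complex.I * ω) ∧
      RelayLink.dtft L.t₁₂ ω = starRingEnd ℂ (RelayLink.dtft L.t₂₁ ω) ∧
      RelayLink.dtft L.t₂₂ ω =
        1 + L.d₁ * Complex.exp (-(Complex.I * ω)) + L.d₁ * Complex.exp (Complex.I * ω)) := by
  have hγ : 0 ≤ 2 / (numTransmitters : ℝ) * L.snr :=
    mul_nonneg (by positivity) (div_nonneg L.Ps_pos.le L.N0_pos.le)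
  have hH := fun n => L.channelMatrix_posSemidef (hz n)
  have hT := fun n => L.blockToeplitz_taps_posSemidef (hH n)
  have hlogDet : ∀ n, L.logDet n = Real.log
      (1 + ((2 / (numTransmitters : ℝ) * L.snr : ℝ) : ℂ) • blockToeplitz L.taps n).det.re :=
    fun n => by rw [RelayLink.logDet, L.det_one_add_smul_blockMatrix]
  have hinfo : ∀ n, mutualInfo P (L.output n (b n) (z n)) (b n) = ENNReal.ofReal (L.logDet n) := by
    intro n
    have hp : 0 < L.symbolPower :=
      mul_pos (div_pos two_pos (by norm_num [numTransmitters])) L.Ps_pos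
    have h := mutualInfo_mulVec_add (hH n) hp L.N0_pos (hb n) (hz n) (hbz n)
    rw [L.det_one_add_smul_channelMatrix, show L.symbolPower / L.N0 =
      2 / (numTransmitters : ℝ) * L.snr from mul_div_assoc _ _ _, ← hlogDet] at h
    exact h
  have hnonneg : ∀ n, 0 ≤ L.logDet n := fun n => by
    rw [hlogDet]
    exact Real.log_nonneg (one_le_det_one_add_smul (hT n) hγ)
  have hinfo' : ∀ n, (mutualInfo P (L.output n (b n) (z n)) (b n)).toReal = L.logDet n := fun n => by
    rw [hinfo, ENNReal.toReal_ofReal (hnonneg n)]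
  have hrate : L.rateDensity = fun ω => Real.log
      (1 + ((2 / (numTransmitters : ℝ) * L.snr : ℝ) : ℂ) • trigSymbol L.taps 2 ω).det.re := by
    funext ω
    rw [← L.symbol_eq_trigSymbol]
    refine L.rateDensity_eq_log_det ?_
    rw [L.symbol_eq_trigSymbol]
    exact trigSymbol_posSemidef 2 L.taps_neg L.taps_eq_zero hT ω
  obtain ⟨hcont, hlim⟩ := tendsto_logDet_blockToeplitz 2 L.taps_neg L.taps_eq_zero hT hγ
  rw [← hrate] at hcont
  simp only [← hlogDet, ← congrFun hrate] at hlim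
  refine ⟨fun n => ⟨by rw [hinfo]; exact ENNReal.ofReal_ne_top, hinfo' n⟩,
    hcont.intervalIntegrable _ _, ?_, hlim, fun ω => ⟨L.dtft_t₁₁ ω, L.dtft_t₁₂ ω, ?_, L.dtft_t₂₂ ω⟩⟩
  · simpa only [hinfo'] using hlim
  · rw [← RelayLink.conj_dtft L.t₁₂ L.t₂₁ (fun _ => rfl) ω, Complex.conj_conj]
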